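/- Let $\mathcal H_1$ be a complex Hilbert space and $M$ a positive, injective, self-adjoint (possibly unbounded) operator on $\mathcal H_1$; let $M^{1/2}$ be its positive self-adjoint square root and $M^{-1/2}=(M^{1/2})^{-1}$, with domain the range of $M^{1/2}$. Let $\mathcal F(\mathcal H_1)$ be the Fock space of symmetric tensors over $\mathcal H_1$, with symmetric tensor product $\circ$ normalized by $(f_1\circ\cdots\circ f_n\mid g_1\circ\cdots\circ g_n)=\sum_\sigma\prod_i(f_i\mid g_{\sigma(i)})$ and exponential vectors $\exp f=\sum_{n\ge0}\frac1{n!}f^{\circ n}$. Let $H_E=d\Gamma(M)$ be the closure of the operator on $\mathrm{span}\{\exp f: f\in D(M)\}$ given by $\exp f\mapsto (Mf)\circ\exp f$. For $h\in\mathcal H_1$ let the creation operator $a^+(h)$ be the closure of the operator on $\mathrm{span}\{\exp f: f\in\mathcal H_1\}$ given by $\exp f\mapsto h\circ\exp f$, let $a(h)=(a^+(h))^*$, and let the field operator $\Phi(h)$ be the closure of $a^+(h)+a(h)$. Suppose that $h\in D(M^{-1/2})$. Then: (a) for every $\lambda\in\mathbb R$ the operator $H_E+\lambda\Phi(h)$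 has domain $D(H_E)$ and is self-adjoint on it; (b) if moreover $\|M^{-1/2}h\|\le\frac12$, then the operator $H_E-\frac12\Phi(h)^2$, where $\Phi(h)^2$ has its natural domain $\{\psi\in D(\Phi(h)):\Phi(h)\psi\in D(\Phi(h))\}$, has domain $D(H_E)$, is symmetric, and satisfies $H_E-\frac12\Phi(h)^2\ge-\|h\|^2$, that is, $(\psi\mid (H_E-\frac12\Phi(h)^2)\psi)\ge-\|h\|^2\|\psi\|^2$ for all $\psi\in D(H_E)$. -/

import Mathlib

noncomputable section

open scoped TensorProduct InnerProductSpace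

namespace BosonFock

universe u

/-! ### Unbounded operators -/

section Operators

variable {E : Type u} [NormedAddCommGroup E] [InnerProductSpace ℂ E]

/-- The product `B A` of two unbounded operators on its natural domain
`{x ∈ D(A) | A x ∈ D(B)}`. -/
def opComp (B A : E →ₗ.[ℂ] E) : E →ₗ.[ℂ] E :=
  B.comp (A.domRestrict ((B.domain.comap A.toFun).map A.domain.subtype)) (by
    rintro ⟨x, hx, hx'⟩
    obtain ⟨y, hy, hyx⟩ := hx
    have : (⟨x, hx'⟩ : A.domain) = y := Subtype.ext hyx.symm
    change A.toFun ⟨x, hx'⟩ ∈ B.domain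
    rw [this]
    exact hy)

/-- `A` is a positive operator: `(x | A x) ≥ 0` for all `x ∈ D(A)`. -/
def IsPositiveOp (A : E →ₗ.[ℂ] E) : Prop :=
  ∀ x : A.domain, 0 ≤ (⟪(x : E), A x⟫_ℂ).re

/-- `A ≥ c`: the operator `A` is symmetric and `(x | A x) ≥ c ‖x‖²` for all `x ∈ D(A)`. -/
def HasLowerBound (A : E →ₗ.[ℂ] E) (c : ℝ) : Prop :=
  A.IsFormalAdjoint A ∧ ∀ x : A.domain, c * ‖(x : E)‖ ^ 2 ≤ (⟪(x : E), A x⟫_ℂ).re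

variable [CompleteSpace E]

/-- `S` is a positive self-adjoint square root of `A`. -/
def IsPosSqrt (S A : E →ₗ.[ℂ] E) : Prop :=
  IsSelfAdjoint S ∧ IsPositiveOp S ∧ opComp S S = A

open scoped Classical in
/-- `A ^ (1/2)`, the positive self-adjoint square root; every positive self-adjoint operator `A` has
exactly one. (The value for operators without a positive self-adjoint square root is arbitrary.) -/
def posSqrt (A : E →ₗ.[ℂ] E) : E →ₗ.[ℂ] E :=
  if hA : ∃ S : E →ₗ.[ℂ] E, IsPosSqrt S A then hA.choose else ⊥

/-- `A ^ (-1/2)`, the inverse of `A ^ (1/2)`, with domain the range of `A ^ (1/2)`. -/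
def invSqrt (A : E →ₗ.[ℂ] E) : E →ₗ.[ℂ] E :=
  (posSqrt A).inverse

end Operators

/-! ### Tensor powers -/

/-- A bundled complex inner product space. -/
structure PreHilbert where
  carrier : Type u
  [nacg : NormedAddCommGroup carrier]
  [ips : InnerProductSpace ℂ carrier]

attribute [instance] PreHilbert.nacg PreHilbert.ips

variable (H : Type u) [NormedAddCommGroup H] [InnerProductSpace ℂ H]

/-- The algebraic tensor powers `ℂ, H ⊗ ℂ, H ⊗ (H ⊗ ℂ), …` with their inner products. -/
def tensorPowBundled : ℕ → PreHilbert.{u}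
  | 0 => ⟨EuclideanSpace ℂ PUnit.{u + 1}⟩
  | n + 1 => ⟨H ⊗[ℂ] (tensorPowBundled n).carrier⟩

/-- The `n`-fold algebraic tensor power of `H`. -/
def TensorPow (n : ℕ) : Type u := (tensorPowBundled H n).carrier

instance (n : ℕ) : NormedAddCommGroup (TensorPow H n) := (tensorPowBundled H n).nacg

instance (n : ℕ) : InnerProductSpace ℂ (TensorPow H n) := (tensorPowBundled H n).ips

variable {H}

/-- The elementary tensor `f₀ ⊗ f₁ ⊗ ⋯ ⊗ fₙ₋₁`. -/
def tprod : (n : ℕ) → (Fin n → H) → TensorPow H n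
  | 0, _ => EuclideanSpace.single PUnit.unit (1 : ℂ)
  | n + 1, f => (f 0 ⊗ₜ[ℂ] tprod n (Fin.tail f) : H ⊗[ℂ] TensorPow H n)

theorem inner_tprod : ∀ (n : ℕ) (f g : Fin n → H),
    ⟪tprod n f, tprod n g⟫_ℂ = ∏ i, ⟪f i, g i⟫_ℂ
  | 0, f, g => by
    change ⟪(EuclideanSpace.single PUnit.unit (1 : ℂ) : EuclideanSpace ℂ PUnit.{u + 1}),
      EuclideanSpace.single PUnit.unit (1 : ℂ)⟫_ℂ = _
    simp
  | n + 1, f, g => by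
    change ⟪(f 0 ⊗ₜ[ℂ] tprod n (Fin.tail f) : H ⊗[ℂ] TensorPow H n),
      g 0 ⊗ₜ[ℂ] tprod n (Fin.tail g)⟫_ℂ = _
    rw [TensorProduct.inner_tmul, inner_tprod n, Fin.prod_univ_succ]
    rfl

theorem norm_tprod (n : ℕ) (f : Fin n → H) : ‖tprod n f‖ = ∏ i, ‖f i‖ := by
  have h := inner_tprod n f f
  simp only [inner_self_eq_norm_sq_to_K] at h
  have h2 : ‖tprod n f‖ ^ 2 = (∏ i, ‖f i‖) ^ 2 := by
    rw [← Finset.prod_pow]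
    exact_mod_cast h
  exact (pow_left_inj₀ (norm_nonneg _) (Finset.prod_nonneg fun i _ => norm_nonneg _)
    two_ne_zero).1 h2

/-! ### The Fock space of symmetric tensors -/

/-- The symmetric tensor product
`f₁ ∘ ⋯ ∘ fₙ = (n!)^(-1/2) ∑_σ f_σ(1) ⊗ ⋯ ⊗ f_σ(n)` in the completed tensor power. The normalization
is `(f₁ ∘ ⋯ ∘ fₙ | g₁ ∘ ⋯ ∘ gₙ) = ∑_σ ∏ᵢ (fᵢ | g_σ(i))`. -/
def symTensor (n : ℕ) (f : Fin n → H) : UniformSpace.Completion (TensorPow H n) :=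
  (((Real.sqrt (n.factorial : ℝ))⁻¹ : ℝ) : ℂ) •
    ∑ σ : Equiv.Perm (Fin n),
      ((tprod n (fun i => f (σ i)) : TensorPow H n) : UniformSpace.Completion (TensorPow H n))

variable (H) in
/-- The `n`-particle space: the Hilbert space of symmetric tensors of degree `n`. -/
def SymPow (n : ℕ) : Submodule ℂ (UniformSpace.Completion (TensorPow H n)) :=
  (Submodule.span ℂ (Set.range (symTensor (H := H) n))).topologicalClosure

instance (n : ℕ) : CompleteSpace (SymPow H n) :=
  (Submodule.isClosed_topologicalClosure _).completeSpace_coe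

variable (H) in
/-- The Fock space of symmetric tensors over `H`, the Hilbert sum of the `n`-particle spaces. -/
abbrev Fock : Type u := lp (fun n : ℕ => SymPow H n) 2

/-- The symmetric tensor product `f₁ ∘ ⋯ ∘ fₙ` as an element of the `n`-particle space. -/
def symProd (n : ℕ) (f : Fin n → H) : SymPow H n :=
  ⟨symTensor n f, Submodule.le_topologicalClosure _ (Submodule.subset_span ⟨f, rfl⟩)⟩

theorem norm_symProd_le (n : ℕ) (f : Fin n → H) :
    ‖symProd n f‖ ≤ Real.sqrt (n.factorial : ℝ) * ∏ i, ‖f i‖ := by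
  have hpos : (0 : ℝ) < n.factorial := by exact_mod_cast n.factorial_pos
  have h1 : ‖∑ σ : Equiv.Perm (Fin n), ((tprod n (fun i => f (σ i)) : TensorPow H n) :
      UniformSpace.Completion (TensorPow H n))‖ ≤ (n.factorial : ℝ) * ∏ i, ‖f i‖ := by
    refine (norm_sum_le _ _).trans (le_of_eq ?_)
    have : ∀ σ : Equiv.Perm (Fin n), ‖((tprod n (fun i => f (σ i)) : TensorPow H n) :
        UniformSpace.Completion (TensorPow H n))‖ = ∏ i, ‖f i‖ := fun σ => by
      rw [UniformSpace.Completion.norm_coe, norm_tprod]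
      exact Equiv.prod_comp σ fun i => ‖f i‖
    simp [this, Finset.card_univ, Fintype.card_perm]
  change ‖symTensor n f‖ ≤ _
  rw [symTensor, norm_smul, Complex.norm_real, Real.norm_of_nonneg (by positivity)]
  calc _ ≤ (Real.sqrt (n.factorial : ℝ))⁻¹ * ((n.factorial : ℝ) * ∏ i, ‖f i‖) := by gcongr
    _ = Real.sqrt (n.factorial : ℝ) * ∏ i, ‖f i‖ := by
      rw [← mul_assoc]
      congr 1
      rw [inv_mul_eq_div, Real.div_sqrt]

/-- The components `f^∘n / n!` of the exponential vector `exp f`. -/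
def expSeq (f : H) (n : ℕ) : SymPow H n :=
  ((n.factorial : ℂ)⁻¹) • symProd n (fun _ => f)

/-- The components `0, g, g ∘ f, …, (g ∘ f^∘n) / n!, …` of `g ∘ exp f`. -/
def circExpSeq (g f : H) : (n : ℕ) → SymPow H n
  | 0 => 0
  | n + 1 => ((n.factorial : ℂ)⁻¹) • symProd (n + 1) (Fin.cons g fun _ => f)

theorem memℓp_expSeq (f : H) : Memℓp (expSeq f) 2 := by
  refine memℓp_gen (Summable.of_nonneg_of_le (fun n => by positivity) (fun n => ?_)
    (Real.summable_pow_div_factorial (‖f‖ ^ 2)))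
  have hpos : (0 : ℝ) < n.factorial := by exact_mod_cast n.factorial_pos
  have h := norm_symProd_le n (fun _ => f)
  simp only [Finset.prod_const, Finset.card_univ, Fintype.card_fin] at h
  simp only [ENNReal.toReal_ofNat, Real.rpow_ofNat]
  rw [expSeq, norm_smul, norm_inv, Complex.norm_natCast]
  calc _ ≤ ((n.factorial : ℝ)⁻¹ * (Real.sqrt (n.factorial : ℝ) * ‖f‖ ^ n)) ^ 2 := by gcongr
    _ = _ := by
      rw [mul_pow, mul_pow, Real.sq_sqrt hpos.le]
      field_simp
      ring

theorem memℓp_circExpSeq (g f : H) : Memℓp (circExpSeq g f) 2 := by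
  refine memℓp_gen ((summable_nat_add_iff 1).1 ?_)
  refine Summable.of_nonneg_of_le (fun n => by positivity) (fun n => ?_)
    ((Real.summable_pow_div_factorial (2 * ‖f‖ ^ 2)).mul_left (‖g‖ ^ 2))
  have hpos : (0 : ℝ) < n.factorial := by exact_mod_cast n.factorial_pos
  have h := norm_symProd_le (n + 1) (Fin.cons g fun _ => f)
  rw [Fin.prod_univ_succ] at h
  simp only [Fin.cons_zero, Fin.cons_succ, Finset.prod_const, Finset.card_univ,
    Fintype.card_fin] at h
  simp only [ENNReal.toReal_ofNat, Real.rpow_ofNat]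
  rw [circExpSeq, norm_smul, norm_inv, Complex.norm_natCast]
  have hn : ((n : ℝ) + 1) ≤ 2 ^ n := by exact_mod_cast Nat.lt_two_pow_self
  calc _ ≤ ((n.factorial : ℝ)⁻¹ *
        (Real.sqrt ((n + 1).factorial : ℝ) * (‖g‖ * ‖f‖ ^ n))) ^ 2 := by gcongr
    _ = ‖g‖ ^ 2 * (((n : ℝ) + 1) * (‖f‖ ^ 2) ^ n / n.factorial) := by
      rw [mul_pow, mul_pow, Real.sq_sqrt (by positivity), Nat.factorial_succ]
      push_cast
      field_simp
      ring
    _ ≤ ‖g‖ ^ 2 * ((2 ^ n) * (‖f‖ ^ 2) ^ n / n.factorial) := by gcongr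
    _ = _ := by rw [mul_pow]

/-- The exponential vector `exp f = 1 + f + (1/2) f ∘ f + ⋯`. -/
def expVec (f : H) : Fock H := ⟨expSeq f, memℓp_expSeq f⟩

/-- The vector `g ∘ exp f`. -/
def circExp (g f : H) : Fock H := ⟨circExpSeq g f, memℓp_circExpSeq g f⟩

/-! ### Operators on the Fock space -/

/-- The creation operator `a⁺(h)`: the closure of the operator on the span of the exponential
vectors that is given by `a⁺(h) exp f = h ∘ exp f`. -/
def creation (h : H) : Fock H →ₗ.[ℂ] Fock H :=
  (Submodule.span ℂ
    (Set.range fun f : H => (expVec f, circExp h f))).toLinearPMap.closure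

variable [CompleteSpace H]

/-- The annihilation operator `a(h)`, the adjoint of `a⁺(h)`. -/
def annihilation (h : H) : Fock H →ₗ.[ℂ] Fock H :=
  (creation h).adjoint

/-- The field operator `Φ(h)`, the closure of `a⁺(h) + a(h)`. -/
def field (h : H) : Fock H →ₗ.[ℂ] Fock H :=
  (creation h + annihilation h).closure

/-- The derivation `dΓ(M)`: the closure of the operator on the span of the exponential vectors
`exp f`, `f ∈ D(M)`, that is given by `dΓ(M) exp f = (M f) ∘ exp f`. -/
def dGamma (M : H →ₗ.[ℂ] H) : Fock H →ₗ.[ℂ] Fock H :=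
  (Submodule.span ℂ
    (Set.range fun f : M.domain => (expVec (f : H), circExp (M f) (f : H)))).toLinearPMap.closure

end BosonFock

end

/-!
Write `H_E = dΓ(M)` and let `c = ‖M ^ (-1/2) h‖`. The operator `M ^ (-1/2)` enters only through the
inequality `|(h | f)|² ≤ c² (f | M f)` on `D(M)` (`norm_inner_sq_le_of_mem_invSqrt`). Everything on
the Fock space is computed on exponential vectors. They are total, `(exp f | exp g) = e ^ (f | g)`,
and `f ↦ exp f` is an entire function with derivative `g ↦ g ∘ exp f`, so that all other inner
products, such as `(g ∘ exp f | g' ∘ exp k)`, are obtained by differentiation. Totality holds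
because the derivatives of `f ↦ exp f` at the origin are the symmetric tensors.

Self-adjointness of `H_E`: on the core `H_E` is symmetric and positive, so it suffices that
`H_E + μ`, `μ > 0`, has dense range there. If `ψ` is orthogonal to the range and `F' = -M F`, then
`u s = (ψ | exp (F s))` satisfies `u' = μ u`; if `F` is bounded for `s ≥ 0`, so is `u`, and then
`u 0 = 0` (`eq_zero_of_inner_dGammaCore_add`). Such `F` exist for a dense set of initial values, by
functional calculus of the bounded operator `(M + 1)⁻¹` (`exists_dense_flow`).

Relative bounds: for `x = ∑ cᵢ exp fᵢ` the differences `c² (x | H_E x) - ‖a(h) x‖²` and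
`c⁴ ‖H_E x‖² - ‖a(h)² x‖²` are quadratic forms in the coefficients whose kernels are sums of
entrywise products of positive semidefinite kernels, and the Schur product theorem applies. With the
commutation relation `‖a⁺(h) x‖² = ‖a(h) x‖² + ‖h‖² ‖x‖²` this gives
`‖Φ(h) x‖² ≤ 4 c² (x | H_E x) + 2 ‖h‖² ‖x‖²` and bounds `Φ(h)²` by `H_E`; by taking limits,
`D(H_E) ⊆ D(Φ(h)²)` (`exists_field_field`).

The form bound makes `λ Φ(h) (H_E + μ)⁻¹` a contraction for large `μ`, so `H_E + λ Φ(h) + μ` is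
surjective, and a symmetric operator with this property is self-adjoint
(`isSelfAdjoint_add_of_form_bound`). For `c ≤ 1/2` the form bound gives
`‖Φ(h) x‖² / 2 ≤ (x | H_E x) / 2 + ‖h‖² ‖x‖²`, which is the lower bound for `H_E - Φ(h)² / 2`.
-/

noncomputable section

open scoped TensorProduct InnerProductSpace

namespace BosonFock

universe u

/-! ### Symmetric tensor products and exponential vectors -/

section Multilinear

variable {H : Type u} [NormedAddCommGroup H] [InnerProductSpace ℂ H]

theorem tprod_update_add : ∀ (n : ℕ) (f : Fin n → H) (i : Fin n) (x y : H),
    tprod n (Function.update f i (x + y)) =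
      tprod n (Function.update f i x) + tprod n (Function.update f i y)
  | 0, _, i, _, _ => i.elim0
  | n + 1, f, i, x, y => by
    change (_ ⊗ₜ[ℂ] _ : H ⊗[ℂ] TensorPow H n) = _ ⊗ₜ[ℂ] _ + _ ⊗ₜ[ℂ] _
    refine Fin.cases ?_ (fun j => ?_) i
    · simp only [Function.update_self, Fin.tail_update_zero, TensorProduct.add_tmul]
      rfl
    · simp only [Fin.tail_update_succ, tprod_update_add n, TensorProduct.tmul_add]
      simp only [Function.update_of_ne (Fin.succ_ne_zero j).symm]
      rfl

theorem tprod_update_smul : ∀ (n : ℕ) (f : Fin n → H) (i : Fin n) (c : ℂ) (x : H),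
    tprod n (Function.update f i (c • x)) = c • tprod n (Function.update f i x)
  | 0, _, i, _, _ => i.elim0
  | n + 1, f, i, c, x => by
    change (_ ⊗ₜ[ℂ] _ : H ⊗[ℂ] TensorPow H n) = c • (_ ⊗ₜ[ℂ] _ : H ⊗[ℂ] TensorPow H n)
    refine Fin.cases ?_ (fun j => ?_) i
    · simp only [Function.update_self, Fin.tail_update_zero, TensorProduct.smul_tmul']
    · simp only [Fin.tail_update_succ, tprod_update_smul n, TensorProduct.tmul_smul]
      simp [Function.update_of_ne (Fin.succ_ne_zero j).symm]

variable (H) in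
/-- The map `(f₁, …, fₙ) ↦ f₁ ⊗ ⋯ ⊗ fₙ` into the completed tensor power. -/
def tprodMultilinear (n : ℕ) :
    MultilinearMap ℂ (fun _ : Fin n => H) (UniformSpace.Completion (TensorPow H n)) :=
  MultilinearMap.mk' (fun f => ((tprod n f : TensorPow H n) : UniformSpace.Completion _))
    (fun f i x y => by rw [tprod_update_add, UniformSpace.Completion.coe_add])
    (fun f i c x => by rw [tprod_update_smul, UniformSpace.Completion.coe_smul])

variable (H) in
/-- The map `(f₁, …, fₙ) ↦ f₁ ∘ ⋯ ∘ fₙ` into the completed tensor power, as a multilinear map. -/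
def symTensorMultilinear (n : ℕ) :
    MultilinearMap ℂ (fun _ : Fin n => H) (UniformSpace.Completion (TensorPow H n)) :=
  (((Real.sqrt (n.factorial : ℝ))⁻¹ : ℝ) : ℂ) •
    ∑ σ : Equiv.Perm (Fin n), (tprodMultilinear H n).domDomCongr σ

theorem symTensorMultilinear_apply (n : ℕ) (f : Fin n → H) :
    symTensorMultilinear H n f = symTensor n f := by
  simp [symTensorMultilinear, symTensor, tprodMultilinear]

variable (H) in
/-- The symmetric tensor product `(f₁, …, fₙ) ↦ f₁ ∘ ⋯ ∘ fₙ` as a bounded multilinear map. -/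
def symProdMultilinear (n : ℕ) :
    ContinuousMultilinearMap ℂ (fun _ : Fin n => H) (SymPow H n) :=
  ((symTensorMultilinear H n).codRestrict (SymPow H n) (fun f => by
    rw [symTensorMultilinear_apply]; exact (symProd n f).2)).mkContinuous
      (Real.sqrt (n.factorial : ℝ)) (fun f => by
        have h := norm_symProd_le n f
        change ‖symTensor n f‖ ≤ _ at h
        change ‖symTensorMultilinear H n f‖ ≤ _
        rwa [symTensorMultilinear_apply])

theorem symProdMultilinear_apply (n : ℕ) (f : Fin n → H) :
    symProdMultilinear H n f = symProd n f :=
  Subtype.ext (symTensorMultilinear_apply n f)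

theorem symProd_comp_perm (n : ℕ) (f : Fin n → H) (σ : Equiv.Perm (Fin n)) :
    symProd n (fun i => f (σ i)) = symProd n f := by
  refine Subtype.ext ?_
  change symTensor n (fun i => f (σ i)) = symTensor n f
  rw [symTensor, symTensor]
  refine congrArg _ ?_
  exact Equiv.sum_comp (Equiv.mulLeft σ) (fun τ : Equiv.Perm (Fin n) =>
    ((tprod n (fun i => f (τ i)) : TensorPow H n) : UniformSpace.Completion (TensorPow H n)))

theorem symProd_update_const (n : ℕ) (f g : H) (i : Fin (n + 1)) :
    symProd (n + 1) (Function.update (fun _ => f) i g) =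
      symProd (n + 1) (Fin.cons g fun _ => f) := by
  rw [← symProd_comp_perm _ (Fin.cons g fun _ => f) (Equiv.swap 0 i)]
  congr 1
  funext j
  by_cases hj : j = i
  · subst hj; simp
  · rw [Function.update_of_ne hj]
    by_cases h0 : j = 0
    · subst h0
      obtain ⟨k, rfl⟩ := Fin.exists_succ_eq.2 (Ne.symm hj)
      simp
    · rw [Equiv.swap_apply_of_ne_of_ne h0 hj]
      obtain ⟨k, rfl⟩ := Fin.exists_succ_eq.2 h0
      simp

theorem inner_symProd_const (n : ℕ) (f g : H) :
    ⟪symProd n (fun _ => f), symProd n (fun _ => g)⟫_ℂ = n.factorial * ⟪f, g⟫_ℂ ^ n := by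
  have hpos : (0 : ℝ) < n.factorial := by exact_mod_cast n.factorial_pos
  have h : ∀ f : H, symTensor n (fun _ => f) = ((Real.sqrt (n.factorial : ℝ) : ℝ) : ℂ) •
      ((tprod n (fun _ => f) : TensorPow H n) : UniformSpace.Completion (TensorPow H n)) := by
    intro f
    simp only [symTensor, Finset.sum_const, Finset.card_univ, Fintype.card_perm, Fintype.card_fin]
    rw [← Nat.cast_smul_eq_nsmul ℂ, smul_smul]
    congr 1
    rw [← Complex.ofReal_natCast, ← Complex.ofReal_mul, inv_mul_eq_div, Real.div_sqrt]
  change ⟪symTensor n (fun _ => f), symTensor n (fun _ => g)⟫_ℂ = _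
  rw [h, h, inner_smul_left, inner_smul_right, UniformSpace.Completion.inner_coe, inner_tprod]
  simp only [Finset.prod_const, Finset.card_univ, Fintype.card_fin, Complex.conj_ofReal]
  rw [← mul_assoc, ← Complex.ofReal_mul, Real.mul_self_sqrt hpos.le, Complex.ofReal_natCast]

end Multilinear

section ExpVec

variable {H : Type u} [NormedAddCommGroup H] [InnerProductSpace ℂ H]

theorem inner_expSeq (n : ℕ) (f g : H) :
    ⟪expSeq f n, expSeq g n⟫_ℂ = ((n.factorial : ℂ)⁻¹) • ⟪f, g⟫_ℂ ^ n := by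
  have hpos : (n.factorial : ℂ) ≠ 0 := by exact_mod_cast n.factorial_ne_zero
  refine (inner_smul_left (E := SymPow H n) _ _ _).trans ?_
  refine (congrArg _ (inner_smul_right (E := SymPow H n) _ _ _)).trans ?_
  rw [inner_symProd_const, map_inv₀, Complex.conj_natCast, smul_eq_mul]
  field_simp

theorem inner_expVec (f g : H) : ⟪expVec f, expVec g⟫_ℂ = Complex.exp ⟪f, g⟫_ℂ := by
  have h := lp.hasSum_inner (𝕜 := ℂ) (expVec f) (expVec g)
  have h2 : ∀ n, ⟪expVec f n, expVec g n⟫_ℂ = ((n.factorial : ℂ)⁻¹) • ⟪f, g⟫_ℂ ^ n :=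
    fun n => inner_expSeq n f g
  simp only [h2] at h
  rw [Complex.exp_eq_exp_ℂ]
  exact h.unique (NormedSpace.exp_series_hasSum_exp' (𝕂 := ℂ) _)

variable (H) in
/-- The power series of `f ↦ exp f` at the origin. -/
def expVecSeries : FormalMultilinearSeries ℂ H (Fock H) := fun n =>
  ((n.factorial : ℂ)⁻¹) •
    (lp.singleContinuousLinearMap ℂ (fun n : ℕ => SymPow H n) 2 n).compContinuousMultilinearMap
      (symProdMultilinear H n)

theorem expVecSeries_apply (n : ℕ) (f : Fin n → H) :
    expVecSeries H n f =
      lp.single (E := fun n : ℕ => SymPow H n) 2 n (((n.factorial : ℂ)⁻¹) • symProd n f) := by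
  rw [lp.single_smul, ← symProdMultilinear_apply]
  rfl

theorem norm_expVecSeries_le (n : ℕ) :
    ‖expVecSeries H n‖ ≤ (Real.sqrt (n.factorial : ℝ))⁻¹ := by
  have hpos : (0 : ℝ) < n.factorial := by exact_mod_cast n.factorial_pos
  refine ContinuousMultilinearMap.opNorm_le_bound (by positivity) fun f => ?_
  rw [expVecSeries_apply, lp.norm_single (by norm_num), norm_smul, norm_inv, Complex.norm_natCast]
  calc _ ≤ (n.factorial : ℝ)⁻¹ * (Real.sqrt (n.factorial : ℝ) * ∏ i, ‖f i‖) := by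
        gcongr; exact norm_symProd_le n f
    _ = _ := by
      rw [← mul_assoc]
      congr 1
      rw [inv_mul_eq_div, Real.sqrt_div_self', one_div]

theorem radius_expVecSeries : (expVecSeries H).radius = ⊤ := by
  refine FormalMultilinearSeries.radius_eq_top_of_summable_norm _ fun r => ?_
  refine Summable.of_nonneg_of_le (fun n => by positivity) (fun n => ?_)
    ((Real.summable_pow_div_factorial ((2 * (r : ℝ)) ^ 2)).add
      (summable_geometric_of_lt_one (r := (1 / 4 : ℝ)) (by norm_num) (by norm_num)))
  have hpos : (0 : ℝ) < n.factorial := by exact_mod_cast n.factorial_pos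
  have h1 : ‖expVecSeries H n‖ * (r : ℝ) ^ n ≤ (Real.sqrt (n.factorial : ℝ))⁻¹ * (r : ℝ) ^ n := by
    gcongr; exact norm_expVecSeries_le n
  refine h1.trans ?_
  -- Summability of `r ^ n / √n!` follows from `2 a b ≤ a² + b²` with
  -- `a = (2 r) ^ n / √n!` and `b = 2 ^ (-n)`.
  have h2 : (Real.sqrt (n.factorial : ℝ))⁻¹ * (r : ℝ) ^ n =
      ((Real.sqrt (n.factorial : ℝ))⁻¹ * (2 * (r : ℝ)) ^ n) * (1 / 2) ^ n := by
    rw [mul_assoc, ← mul_pow]; congr 2; ring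
  have h3 : ((2 * (r : ℝ)) ^ 2) ^ n / n.factorial =
      ((Real.sqrt (n.factorial : ℝ))⁻¹ * (2 * (r : ℝ)) ^ n) ^ 2 := by
    rw [mul_pow (Real.sqrt _)⁻¹, inv_pow, Real.sq_sqrt hpos.le, ← pow_mul, ← pow_mul,
      mul_comm 2 n]
    ring
  have h4 : (1 / 4 : ℝ) ^ n = ((1 / 2) ^ n) ^ 2 := by
    rw [← pow_mul, mul_comm, pow_mul]; norm_num
  rw [h2, h3, h4]
  nlinarith [sq_nonneg ((Real.sqrt (n.factorial : ℝ))⁻¹ * (2 * (r : ℝ)) ^ n - (1 / 2) ^ n),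
    sq_nonneg ((Real.sqrt (n.factorial : ℝ))⁻¹ * (2 * (r : ℝ)) ^ n), sq_nonneg ((1 / 2 : ℝ) ^ n)]

theorem hasFPowerSeriesOnBall_expVec :
    HasFPowerSeriesOnBall (expVec (H := H)) (expVecSeries H) 0 ⊤ where
  r_le := radius_expVecSeries.ge
  r_pos := ENNReal.zero_lt_top
  hasSum := by
    intro f _
    rw [zero_add]
    simp only [expVecSeries_apply]
    exact lp.hasSum_single (by norm_num) (expVec f)

theorem analyticAt_expVec (f : H) : AnalyticAt ℂ (expVec (H := H)) f :=
  hasFPowerSeriesOnBall_expVec.analyticAt_of_mem (by simp)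

theorem hasDerivAt_expSeq (n : ℕ) (f g : H) :
    HasDerivAt (fun z : ℂ => expSeq (f + z • g) n) (circExpSeq g f n) 0 := by
  have h1 := ((symProdMultilinear H n).hasFDerivAt (fun _ => f))
  have h2 : HasDerivAt (fun z : ℂ => (fun _ : Fin n => f + z • g)) (fun _ => g) 0 := by
    rw [hasDerivAt_pi]
    intro _
    simpa using ((hasDerivAt_id (0 : ℂ)).smul_const g).const_add f
  have h3 : HasFDerivAt (symProdMultilinear H n) ((symProdMultilinear H n).linearDeriv fun _ => f)
      (fun _ : Fin n => f + (0 : ℂ) • g) := by simpa using h1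
  have h4 := (h3.comp_hasDerivAt (0 : ℂ) h2).const_smul ((n.factorial : ℂ)⁻¹)
  have h5 : ((n.factorial : ℂ)⁻¹) • ((symProdMultilinear H n).linearDeriv fun _ => f) (fun _ => g)
      = circExpSeq g f n := by
    rw [ContinuousMultilinearMap.linearDeriv_apply]
    cases n with
    | zero => simp [circExpSeq]
    | succ n =>
      simp only [symProdMultilinear_apply, symProd_update_const, Finset.sum_const,
        Finset.card_univ, Fintype.card_fin, circExpSeq]
      rw [← Nat.cast_smul_eq_nsmul ℂ, smul_smul]
      congr 1
      have : (n.factorial : ℂ) ≠ 0 := by exact_mod_cast n.factorial_ne_zero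
      have : ((n : ℂ) + 1) ≠ 0 := by exact_mod_cast n.succ_ne_zero
      rw [Nat.factorial_succ]; push_cast; field_simp
  rw [h5] at h4
  refine h4.congr_of_eventuallyEq (Filter.Eventually.of_forall fun z => ?_)
  simp [expSeq, symProdMultilinear_apply]

theorem fderiv_expVec (f g : H) : fderiv ℂ (expVec (H := H)) f g = circExp g f := by
  have h1 := (analyticAt_expVec f).differentiableAt.hasFDerivAt
  have h2 : HasDerivAt (fun z : ℂ => f + z • g) g 0 := by
    simpa using ((hasDerivAt_id (0 : ℂ)).smul_const g).const_add f
  have h3 : HasFDerivAt (expVec (H := H)) (fderiv ℂ (expVec (H := H)) f) (f + (0 : ℂ) • g) := by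
    simpa using h1
  have h4 := h3.comp_hasDerivAt (0 : ℂ) h2
  refine lp.ext (funext fun n => ?_)
  have h5 := ((lp.evalCLM ℂ (fun n : ℕ => SymPow H n) 2 n).hasFDerivAt).comp_hasDerivAt (0 : ℂ) h4
  exact h5.unique (hasDerivAt_expSeq n f g)

theorem hasFDerivAt_expVec (f : H) :
    HasFDerivAt (expVec (H := H)) (fderiv ℂ (expVec (H := H)) f) f :=
  (analyticAt_expVec f).differentiableAt.hasFDerivAt

theorem continuous_expVec : Continuous (expVec (H := H)) :=
  continuous_iff_continuousAt.2 fun f => (analyticAt_expVec f).continuousAt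

/-- The derivative of `z ↦ exp (f + z g)` is `z ↦ g ∘ exp (f + z g)`. -/
theorem hasDerivAt_expVec_line (f g : H) (z : ℂ) :
    HasDerivAt (fun z : ℂ => expVec (f + z • g)) (circExp g (f + z • g)) z := by
  have h2 : HasDerivAt (fun z : ℂ => f + z • g) g z := by
    simpa using ((hasDerivAt_id z).smul_const g).const_add f
  rw [← fderiv_expVec]
  exact (hasFDerivAt_expVec (f + z • g)).comp_hasDerivAt z h2

/-- A vector orthogonal to all exponential vectors vanishes: all derivatives at the origin of
`f ↦ (ψ | exp f)` vanish, and these are the `(ψ | f₁ ∘ ⋯ ∘ fₙ)`. -/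
theorem eq_zero_of_inner_expVec {ψ : Fock H} (h : ∀ f : H, ⟪ψ, expVec f⟫_ℂ = 0) : ψ = 0 := by
  have hps := (innerSL ℂ ψ).comp_hasFPowerSeriesOnBall (hasFPowerSeriesOnBall_expVec (H := H))
  have hz : (innerSL ℂ ψ) ∘ (expVec (H := H)) = fun _ => 0 := funext fun f => h f
  have key : ∀ (n : ℕ) (v : Fin n → H), ⟪ψ n, symProd n v⟫_ℂ = 0 := by
    intro n v
    have h1 := hps.iteratedFDeriv_eq_sum_of_completeSpace v
    rw [hz] at h1
    have h2 : ∀ σ : Equiv.Perm (Fin n),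
        (innerSL ℂ ψ).compFormalMultilinearSeries (expVecSeries H) n (fun i => v (σ i)) =
          ((n.factorial : ℂ)⁻¹) * ⟪ψ n, symProd n v⟫_ℂ := by
      intro σ
      rw [ContinuousLinearMap.compFormalMultilinearSeries_apply']
      change ⟪ψ, expVecSeries H n _⟫_ℂ = _
      rw [expVecSeries_apply, lp.inner_single_right, symProd_comp_perm]
      exact inner_smul_right (𝕜 := ℂ) (E := SymPow H n) _ _ _
    simp only [h2, Finset.sum_const, Finset.card_univ, Fintype.card_perm, Fintype.card_fin] at h1
    have h3 : iteratedFDeriv ℂ n (fun _ : H => (0 : ℂ)) 0 v = 0 := by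
      have := iteratedFDeriv_fun_zero (𝕜 := ℂ) (E := H) (F := ℂ) (n := n)
      have h4 := congrFun this (0 : H)
      exact congrArg (fun m => m v) h4
    rw [h3, nsmul_eq_mul, ← mul_assoc, mul_inv_cancel₀, one_mul] at h1
    · exact h1.symm
    · exact_mod_cast n.factorial_ne_zero
  refine lp.ext (funext fun n => ?_)
  have hle : SymPow H n ≤ (Submodule.span ℂ
      {((ψ n : SymPow H n) : UniformSpace.Completion (TensorPow H n))})ᗮ := by
    refine Submodule.topologicalClosure_minimal _ ?_ (Submodule.isClosed_orthogonal _)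
    refine Submodule.span_le.2 ?_
    rintro _ ⟨v, rfl⟩
    rw [SetLike.mem_coe, Submodule.mem_orthogonal_singleton_iff_inner_right]
    exact key n v
  have := hle (ψ n).2
  rw [Submodule.mem_orthogonal_singleton_iff_inner_right] at this
  exact Subtype.ext (inner_self_eq_zero.1 this)

theorem eq_zero_of_inner_expVec_dense {D : Set H} (hD : Dense D) {ψ : Fock H}
    (h : ∀ f ∈ D, ⟪ψ, expVec f⟫_ℂ = 0) : ψ = 0 :=
  eq_zero_of_inner_expVec fun f => by
    have h1 : Continuous fun f : H => ⟪ψ, expVec f⟫_ℂ := continuous_const.inner continuous_expVec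
    exact congrFun (h1.ext_on hD continuous_const h) f

theorem inner_expVec_circExp (f g k : H) :
    ⟪expVec f, circExp g k⟫_ℂ = ⟪f, g⟫_ℂ * Complex.exp ⟪f, k⟫_ℂ := by
  have h1 := (innerSL ℂ (expVec f)).hasFDerivAt.comp_hasDerivAt (0 : ℂ)
    (hasDerivAt_expVec_line k g 0)
  have h2 : HasDerivAt (fun z : ℂ => Complex.exp (⟪f, k⟫_ℂ + z * ⟪f, g⟫_ℂ))
      (Complex.exp (⟪f, k⟫_ℂ + 0 * ⟪f, g⟫_ℂ) * (1 * ⟪f, g⟫_ℂ)) 0 :=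
    (((hasDerivAt_id (0 : ℂ)).mul_const _).const_add _).cexp
  have h3 : (fun z : ℂ => Complex.exp (⟪f, k⟫_ℂ + z * ⟪f, g⟫_ℂ)) =
      (innerSL ℂ (expVec f)) ∘ (fun z : ℂ => expVec (k + z • g)) := by
    funext z
    simp [inner_expVec]
  rw [h3] at h2
  have h4 := h1.unique h2
  simp only [zero_smul, add_zero, zero_mul, one_mul, innerSL_apply_apply] at h4
  rw [h4, mul_comm]

theorem inner_circExp_expVec (f g k : H) :
    ⟪circExp g k, expVec f⟫_ℂ = ⟪g, f⟫_ℂ * Complex.exp ⟪k, f⟫_ℂ := by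
  rw [← inner_conj_symm, inner_expVec_circExp, map_mul, inner_conj_symm, ← Complex.exp_conj,
    inner_conj_symm]

theorem inner_circExp_circExp (g f g' k : H) :
    ⟪circExp g f, circExp g' k⟫_ℂ =
      (⟪g, g'⟫_ℂ + ⟪g, k⟫_ℂ * ⟪f, g'⟫_ℂ) * Complex.exp ⟪f, k⟫_ℂ := by
  have h1 := (innerSL ℂ (circExp g f)).hasFDerivAt.comp_hasDerivAt (0 : ℂ)
    (hasDerivAt_expVec_line k g' 0)
  have h2 : HasDerivAt (fun z : ℂ => (⟪g, k⟫_ℂ + z * ⟪g, g'⟫_ℂ) *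
        Complex.exp (⟪f, k⟫_ℂ + z * ⟪f, g'⟫_ℂ))
      ((1 * ⟪g, g'⟫_ℂ) * Complex.exp (⟪f, k⟫_ℂ + 0 * ⟪f, g'⟫_ℂ) +
        (⟪g, k⟫_ℂ + 0 * ⟪g, g'⟫_ℂ) *
          (Complex.exp (⟪f, k⟫_ℂ + 0 * ⟪f, g'⟫_ℂ) * (1 * ⟪f, g'⟫_ℂ))) 0 :=
    (((hasDerivAt_id (0 : ℂ)).mul_const _).const_add _).mul
      (((hasDerivAt_id (0 : ℂ)).mul_const _).const_add _).cexp
  have h3 : (fun z : ℂ => (⟪g, k⟫_ℂ + z * ⟪g, g'⟫_ℂ) *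
        Complex.exp (⟪f, k⟫_ℂ + z * ⟪f, g'⟫_ℂ)) =
      (innerSL ℂ (circExp g f)) ∘ (fun z : ℂ => expVec (k + z • g')) := by
    funext z
    simp [inner_circExp_expVec]
  rw [h3] at h2
  have h4 := h1.unique h2
  simp only [zero_smul, add_zero, zero_mul, one_mul, innerSL_apply_apply] at h4
  rw [h4]; ring

theorem norm_expVec_sq (f : H) : ‖expVec f‖ ^ 2 = Real.exp (‖f‖ ^ 2) := by
  have h := inner_expVec f f
  rw [inner_self_eq_norm_sq_to_K, inner_self_eq_norm_sq_to_K] at h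
  have h2 : ((‖expVec f‖ ^ 2 : ℝ) : ℂ) = ((Real.exp (‖f‖ ^ 2) : ℝ) : ℂ) := by
    rw [Complex.ofReal_exp]; push_cast; exact h
  exact_mod_cast h2

end ExpVec

/-! ### Graphs, self-adjointness and resolvents -/

section GraphLemmas

variable {E : Type u} [NormedAddCommGroup E] [InnerProductSpace ℂ E]

theorem graph_closure_toLinearPMap (g : Submodule ℂ (E × E))
    (hg : ∀ p ∈ g.topologicalClosure, p.1 = 0 → p.2 = 0) :
    g.toLinearPMap.closure.graph = g.topologicalClosure := by
  have h0 : g.toLinearPMap.graph = g :=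
    g.toLinearPMap_graph_eq fun p hp => hg p (g.le_topologicalClosure hp)
  have hc : g.toLinearPMap.IsClosable :=
    ⟨g.topologicalClosure.toLinearPMap, by
      rw [h0, Submodule.toLinearPMap_graph_eq _ hg]⟩
  rw [← hc.graph_closure_eq_closure_graph, h0]

/-- If `g` and `g'` are graphs of formally adjoint operators, then so are their closures, apart from
single-valuedness. -/
theorem formalAdjoint_topologicalClosure {g g' : Submodule ℂ (E × E)}
    (h : ∀ p ∈ g, ∀ q ∈ g', ⟪p.2, q.1⟫_ℂ = ⟪p.1, q.2⟫_ℂ) :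
    ∀ p ∈ g.topologicalClosure, ∀ q ∈ g'.topologicalClosure, ⟪p.2, q.1⟫_ℂ = ⟪p.1, q.2⟫_ℂ := by
  have h1 : ∀ p ∈ g.topologicalClosure, ∀ q ∈ g', ⟪p.2, q.1⟫_ℂ = ⟪p.1, q.2⟫_ℂ := by
    intro p hp q hq
    exact closure_minimal (t := {p : E × E | ⟪p.2, q.1⟫_ℂ = ⟪p.1, q.2⟫_ℂ})
      (fun p hp => h p hp q hq) (isClosed_eq (by fun_prop) (by fun_prop)) hp
  intro p hp q hq
  exact closure_minimal (t := {q : E × E | ⟪p.2, q.1⟫_ℂ = ⟪p.1, q.2⟫_ℂ})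
    (fun q hq => h1 p hp q hq) (isClosed_eq (by fun_prop) (by fun_prop)) hq

/-- A graph with a densely defined formal adjoint is single-valued. -/
theorem snd_eq_zero_of_formalAdjoint {g g' : Submodule ℂ (E × E)}
    (h : ∀ p ∈ g, ∀ q ∈ g', ⟪p.2, q.1⟫_ℂ = ⟪p.1, q.2⟫_ℂ)
    (hd : ∀ ψ : E, (∀ q ∈ g', ⟪ψ, q.1⟫_ℂ = 0) → ψ = 0) :
    ∀ p ∈ g, p.1 = 0 → p.2 = 0 := by
  intro p hp hp0
  refine hd _ fun q hq => ?_
  rw [h p hp q hq, hp0, inner_zero_left]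

theorem isFormalAdjoint_iff_graph (A B : E →ₗ.[ℂ] E) :
    A.IsFormalAdjoint B ↔ ∀ p ∈ A.graph, ∀ q ∈ B.graph, ⟪p.2, q.1⟫_ℂ = ⟪p.1, q.2⟫_ℂ := by
  constructor
  · intro h p hp q hq
    obtain ⟨x, hx, hx'⟩ := A.mem_graph_iff.1 hp
    obtain ⟨y, hy, hy'⟩ := B.mem_graph_iff.1 hq
    rw [← hx, ← hx', ← hy, ← hy']
    exact h x y
  · intro h x y
    exact h _ (A.mem_graph x) _ (B.mem_graph y)

theorem mem_graph_opComp {B A : E →ₗ.[ℂ] E} {x y z : E} (hA : (x, y) ∈ A.graph)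
    (hB : (y, z) ∈ B.graph) : (x, z) ∈ (opComp B A).graph := by
  obtain ⟨a, ha, ha'⟩ := A.mem_graph_iff.1 hA
  obtain ⟨b, hb, hb'⟩ := B.mem_graph_iff.1 hB
  simp only at ha ha' hb hb'
  subst ha hb hb'
  have hmem : (a : E) ∈ (opComp B A).domain := by
    refine ⟨⟨a, ?_, rfl⟩, a.2⟩
    change A a ∈ B.domain
    rw [ha']; exact b.2
  refine LinearPMap.mem_graph_iff _ |>.2 ⟨⟨a, hmem⟩, rfl, ?_⟩
  change B ⟨A a, _⟩ = B b
  congr 1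
  exact Subtype.ext ha'

theorem mem_graph_opComp_iff {B A : E →ₗ.[ℂ] E} {x z : E} :
    (x, z) ∈ (opComp B A).graph ↔ ∃ y, (x, y) ∈ A.graph ∧ (y, z) ∈ B.graph := by
  refine ⟨fun h => ?_, fun ⟨y, hA, hB⟩ => mem_graph_opComp hA hB⟩
  obtain ⟨⟨a, ha⟩, rfl, rfl⟩ := LinearPMap.mem_graph_iff _ |>.1 h
  have hB : A ⟨a, ha.2⟩ ∈ B.domain := by
    obtain ⟨y, hy, rfl⟩ := ha.1
    exact hy
  exact ⟨A ⟨a, ha.2⟩, A.mem_graph ⟨a, ha.2⟩, LinearPMap.mem_graph B ⟨_, hB⟩⟩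

/-- A bounded linear relation extends over the closure of its domain. -/
theorem exists_mem_topologicalClosure_of_bound {X Y : Type*} [NormedAddCommGroup X]
    [NormedSpace ℂ X] [CompleteSpace X] [NormedAddCommGroup Y] [NormedSpace ℂ Y] [CompleteSpace Y]
    (V : Submodule ℂ (X × Y)) (C : ℝ) (hC : ∀ p ∈ V, ‖p.2‖ ≤ C * ‖p.1‖)
    {x : X} (hx : x ∈ (V.map (LinearMap.fst ℂ X Y)).topologicalClosure) :
    ∃ y, (x, y) ∈ V.topologicalClosure := by
  have hC' : ∀ p ∈ V.topologicalClosure, ‖p.2‖ ≤ C * ‖p.1‖ := fun p hp =>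
    closure_minimal (t := {p : X × Y | ‖p.2‖ ≤ C * ‖p.1‖}) hC
      (isClosed_le (by fun_prop) (by fun_prop)) hp
  have : CompleteSpace V.topologicalClosure :=
    (Submodule.isClosed_topologicalClosure _).completeSpace_coe
  let L : V.topologicalClosure →L[ℂ] X :=
    (ContinuousLinearMap.fst ℂ X Y).comp V.topologicalClosure.subtypeL
  have hL : AntilipschitzWith (Real.toNNReal (max 1 C)) L := by
    refine L.antilipschitz_of_bound fun p => ?_
    rw [Real.coe_toNNReal _ (by positivity)]
    have h1 := hC' p p.2
    have h2 : 0 ≤ ‖(p : X × Y).1‖ := norm_nonneg _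
    change max ‖(p : X × Y).1‖ ‖(p : X × Y).2‖ ≤ max 1 C * ‖(p : X × Y).1‖
    refine max_le ?_ (h1.trans (by gcongr; exact le_max_right _ _))
    calc _ = 1 * ‖(p : X × Y).1‖ := (one_mul _).symm
      _ ≤ _ := by gcongr; exact le_max_left _ _
  have hcl := hL.isClosed_range L.uniformContinuous
  have hsub : ((V.map (LinearMap.fst ℂ X Y) : Submodule ℂ X) : Set X) ⊆ Set.range L := by
    rintro _ ⟨p, hp, rfl⟩
    exact ⟨⟨p, V.le_topologicalClosure hp⟩, rfl⟩
  obtain ⟨⟨⟨x', y⟩, hp⟩, rfl⟩ := closure_minimal hsub hcl hx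
  exact ⟨y, hp⟩

theorem norm_le_of_nonneg_inner {x y : E} {μ : ℝ} (h : 0 ≤ (⟪x, y⟫_ℂ).re) :
    μ * ‖x‖ ≤ ‖y + (μ : ℂ) • x‖ := by
  have h1 : μ * ‖x‖ ^ 2 ≤ (⟪x, y + (μ : ℂ) • x⟫_ℂ).re := by
    rw [inner_add_right, inner_smul_right, inner_self_eq_norm_sq_to_K, Complex.add_re]
    have : (((μ : ℂ)) * ((‖x‖ : ℝ) : ℂ) ^ 2).re = μ * ‖x‖ ^ 2 := by
      rw [← Complex.ofReal_pow, ← Complex.ofReal_mul, Complex.ofReal_re]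
    change _ ≤ _ + (((μ : ℂ)) * ((‖x‖ : ℝ) : ℂ) ^ 2).re
    linarith
  have h2 : (⟪x, y + (μ : ℂ) • x⟫_ℂ).re ≤ ‖x‖ * ‖y + (μ : ℂ) • x‖ :=
    (Complex.re_le_norm _).trans (norm_inner_le_norm _ _)
  rcases (norm_nonneg x).eq_or_lt with h0 | h0
  · rw [← h0, mul_zero]; exact norm_nonneg _
  · refine le_of_mul_le_mul_left ?_ h0
    nlinarith

end GraphLemmas

section SelfAdjointness

variable {E : Type u} [NormedAddCommGroup E] [InnerProductSpace ℂ E] [CompleteSpace E]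

/-- A symmetric operator `A` for which `A + μ` is surjective for one real `μ` is self-adjoint. -/
theorem isSelfAdjoint_of_surjective {A : E →ₗ.[ℂ] E} (hA : A.IsFormalAdjoint A) (μ : ℝ)
    (hs : ∀ z : E, ∃ x : A.domain, A x + (μ : ℂ) • (x : E) = z) : IsSelfAdjoint A := by
  have hsym : ∀ x y : A.domain,
      ⟪A x + (μ : ℂ) • (x : E), (y : E)⟫_ℂ = ⟪(x : E), A y + (μ : ℂ) • (y : E)⟫_ℂ := by
    intro x y
    rw [inner_add_left, inner_add_right, hA x y, inner_smul_left, inner_smul_right,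
      Complex.conj_ofReal]
  have hzero : ∀ v : E, (∀ y : A.domain, ⟪v, A y + (μ : ℂ) • (y : E)⟫_ℂ = 0) → v = 0 := by
    intro v hv
    obtain ⟨y, hy⟩ := hs v
    have := hv y
    rw [hy] at this
    exact inner_self_eq_zero.1 this
  -- Density of the domain is automatic: a vector `(A + μ) x` orthogonal to `D(A)` has `x = 0`.
  have hdense : Dense (A.domain : Set E) := by
    rw [Submodule.dense_iff_topologicalClosure_eq_top,
      Submodule.topologicalClosure_eq_top_iff, Submodule.eq_bot_iff]
    intro v hv
    obtain ⟨x, rfl⟩ := hs v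
    have hx : (x : E) = 0 := hzero _ fun y => by
      rw [← hsym x y, ← inner_conj_symm, Submodule.mem_orthogonal _ _ |>.1 hv y y.2, map_zero]
    have hx' : x = 0 := Subtype.ext hx
    rw [hx', LinearPMap.map_zero]
    simp
  have hle : A ≤ A.adjoint := LinearPMap.IsFormalAdjoint.le_adjoint hdense hA
  rw [LinearPMap.isSelfAdjoint_def]
  refine (LinearPMap.eq_of_le_of_domain_eq hle (le_antisymm hle.1 fun y hy => ?_)).symm
  obtain ⟨x, hx⟩ := hs (A.adjoint ⟨y, hy⟩ + (μ : ℂ) • y)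
  have hyx : y - (x : E) = 0 := hzero _ fun w => by
    rw [inner_sub_left, sub_eq_zero, ← hsym x w, hx, inner_add_left, inner_add_right,
      LinearPMap.adjoint_isFormalAdjoint hdense ⟨y, hy⟩ w, inner_smul_left, inner_smul_right,
      Complex.conj_ofReal]
  rw [sub_eq_zero.1 hyx]
  exact x.2

/-- Let `g` be a subspace of `E × E` on which `(x | y)` is nonnegative, such that the vectors
`y + μ x`, `(x, y) ∈ g`, are total. Then the closure of `g` has a bounded resolvent at `-μ`. -/
theorem exists_resolvent (g : Submodule ℂ (E × E)) (hpos : ∀ p ∈ g, 0 ≤ (⟪p.1, p.2⟫_ℂ).re)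
    {μ : ℝ} (hμ : 0 < μ)
    (htot : ∀ ψ : E, (∀ p ∈ g, ⟪ψ, p.2 + (μ : ℂ) • p.1⟫_ℂ = 0) → ψ = 0) :
    ∃ R : E →L[ℂ] E, ∀ z, (R z, z - (μ : ℂ) • R z) ∈ g.topologicalClosure := by
  have hpos' : ∀ p ∈ g.topologicalClosure, 0 ≤ (⟪p.1, p.2⟫_ℂ).re := fun p hp =>
    closure_minimal (t := {p : E × E | 0 ≤ (⟪p.1, p.2⟫_ℂ).re}) hpos
      (isClosed_le (by fun_prop) (by fun_prop)) hp
  have : CompleteSpace g.topologicalClosure :=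
    (Submodule.isClosed_topologicalClosure _).completeSpace_coe
  let L : g.topologicalClosure →L[ℂ] E :=
    (ContinuousLinearMap.snd ℂ E E + (μ : ℂ) • ContinuousLinearMap.fst ℂ E E).comp
      g.topologicalClosure.subtypeL
  have hLapp : ∀ p : g.topologicalClosure, L p = (p : E × E).2 + (μ : ℂ) • (p : E × E).1 :=
    fun _ => rfl
  have hbd : ∀ p : g.topologicalClosure, ‖(p : E × E).1‖ ≤ μ⁻¹ * ‖L p‖ := by
    intro p
    have := norm_le_of_nonneg_inner (μ := μ) (hpos' p p.2)
    rw [← hLapp] at this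
    rw [inv_mul_eq_div, le_div_iff₀ hμ, mul_comm]
    exact this
  have hL : AntilipschitzWith (Real.toNNReal (max μ⁻¹ 2)) L := by
    refine L.antilipschitz_of_bound fun p => ?_
    rw [Real.coe_toNNReal _ (by positivity)]
    have h1 := hbd p
    have h2 : ‖(p : E × E).2‖ ≤ 2 * ‖L p‖ := by
      have h3 : (p : E × E).2 = L p - (μ : ℂ) • (p : E × E).1 := by rw [hLapp]; abel
      have h4 : ‖(μ : ℂ) • (p : E × E).1‖ ≤ ‖L p‖ := by
        rw [norm_smul, Complex.norm_real, Real.norm_of_nonneg hμ.le]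
        exact norm_le_of_nonneg_inner (hpos' p p.2)
      have h5 := norm_sub_le (L p) ((μ : ℂ) • (p : E × E).1)
      rw [← h3] at h5
      linarith
    change max ‖(p : E × E).1‖ ‖(p : E × E).2‖ ≤ max μ⁻¹ 2 * ‖L p‖
    refine max_le (h1.trans ?_) (h2.trans ?_)
    · gcongr; exact le_max_left _ _
    · gcongr; exact le_max_right _ _
  have hcl : IsClosed (L.toLinearMap.range : Set E) := by
    rw [LinearMap.coe_range]
    exact hL.isClosed_range L.uniformContinuous
  have hcomp : CompleteSpace L.toLinearMap.range := hcl.completeSpace_coe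
  have htop : L.toLinearMap.range = ⊤ := by
    rw [← Submodule.orthogonal_eq_bot_iff, Submodule.eq_bot_iff]
    intro ψ hψ
    refine htot ψ fun p hp => ?_
    rw [Submodule.mem_orthogonal'] at hψ
    exact hψ _ ⟨⟨p, g.le_topologicalClosure hp⟩, rfl⟩
  let e : g.topologicalClosure ≃ₗ[ℂ] E :=
    LinearEquiv.ofBijective L.toLinearMap ⟨hL.injective, LinearMap.range_eq_top.1 htop⟩
  have he : ∀ z, L (e.symm z) = z := fun z => e.apply_symm_apply z
  refine ⟨(((LinearMap.fst ℂ E E).comp g.topologicalClosure.subtype).comp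
    e.symm.toLinearMap).mkContinuous μ⁻¹ fun z => ?_, fun z => ?_⟩
  · have := hbd (e.symm z)
    rw [he] at this
    exact this
  · have h1 : (z - (μ : ℂ) • ((e.symm z : g.topologicalClosure) : E × E).1) =
        ((e.symm z : g.topologicalClosure) : E × E).2 := by
      have := he z
      rw [hLapp] at this
      nth_rewrite 1 [← this]
      abel
    change (((e.symm z : g.topologicalClosure) : E × E).1,
      z - (μ : ℂ) • ((e.symm z : g.topologicalClosure) : E × E).1) ∈ g.topologicalClosure
    rw [h1]
    exact (e.symm z).2

/-- Perturbation of a positive self-adjoint operator `A` (given by its resolvents) by a symmetric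
operator `B` whose square is bounded by the quadratic form of `A`: the operator `B (A + μ)⁻¹` has
norm less than `1` for large `μ`, so `A + B + μ` is surjective. -/
theorem isSelfAdjoint_add_of_form_bound {A B : E →ₗ.[ℂ] E} (hA : A.IsFormalAdjoint A)
    (hApos : IsPositiveOp A) (hB : B.IsFormalAdjoint B) (hdom : A.domain ≤ B.domain)
    (hres : ∀ μ : ℝ, 0 < μ → ∃ R : E →L[ℂ] E, ∀ z, (R z, z - (μ : ℂ) • R z) ∈ A.graph)
    {a b : ℝ} (ha : 0 ≤ a) (hb : 0 ≤ b)
    (hbd : ∀ p ∈ A.graph, ∀ y, (p.1, y) ∈ B.graph →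
      ‖y‖ ^ 2 ≤ a * (⟪p.1, p.2⟫_ℂ).re + b * ‖p.1‖ ^ 2) :
    IsSelfAdjoint (A + B) := by
  -- With this `μ` the estimate `‖B (A + μ)⁻¹ z‖ ≤ ‖z‖ / 2` holds.
  set μ : ℝ := 1 + 4 * (a + b) with hμdef
  have hμ1 : 1 ≤ μ := by rw [hμdef]; linarith
  have hμ : 0 < μ := by linarith
  obtain ⟨R, hR⟩ := hres μ hμ
  have hRdom : ∀ z, R z ∈ A.domain := fun z => LinearPMap.mem_domain_of_mem_graph (hR z)
  have hRA : ∀ z, A ⟨R z, hRdom z⟩ = z - (μ : ℂ) • R z := fun z =>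
    (LinearPMap.image_iff (hRdom z) |>.2 (hR z)).symm
  let K₀ : E →ₗ[ℂ] E := B.toFun.comp
    (LinearMap.codRestrict B.domain R.toLinearMap fun z => hdom (hRdom z))
  have hK₀ : ∀ z, K₀ z = B ⟨R z, hdom (hRdom z)⟩ := fun _ => rfl
  have hRn : ∀ z, μ * ‖R z‖ ≤ ‖z‖ := by
    intro z
    have h1 : 0 ≤ (⟪R z, z - (μ : ℂ) • R z⟫_ℂ).re := by
      have := hApos ⟨R z, hRdom z⟩
      rwa [hRA] at this
    have := norm_le_of_nonneg_inner (μ := μ) h1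
    rwa [sub_add_cancel] at this
  have hK : ∀ z, ‖K₀ z‖ ≤ 1 / 2 * ‖z‖ := by
    intro z
    have h1 := hbd _ (hR z) (K₀ z) (B.mem_graph ⟨R z, hdom (hRdom z)⟩)
    simp only at h1
    have h2 : (⟪R z, z - (μ : ℂ) • R z⟫_ℂ).re ≤ ‖R z‖ * ‖z‖ := by
      have h3 : (⟪R z, (μ : ℂ) • R z⟫_ℂ).re = μ * ‖R z‖ ^ 2 := by
        rw [inner_smul_right, Complex.re_ofReal_mul]
        congr 1
        exact inner_self_eq_norm_sq (𝕜 := ℂ) (R z)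
      rw [inner_sub_right, Complex.sub_re, h3]
      have h4 : (⟪R z, z⟫_ℂ).re ≤ ‖R z‖ * ‖z‖ :=
        (Complex.re_le_norm _).trans (norm_inner_le_norm _ _)
      have : 0 ≤ μ * ‖R z‖ ^ 2 := by positivity
      linarith
    have h5 := hRn z
    have hz : ‖R z‖ ≤ ‖z‖ := by nlinarith [norm_nonneg (R z)]
    have h6 : (1 + 4 * (a + b)) * ‖R z‖ ≤ ‖z‖ := h5
    have h7 : ‖K₀ z‖ ^ 2 ≤ (1 / 2 * ‖z‖) ^ 2 := by
      have e1 : a * (⟪R z, z - (μ : ℂ) • R z⟫_ℂ).re ≤ a * (‖R z‖ * ‖z‖) := by gcongr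
      have e2 : b * ‖R z‖ ^ 2 ≤ b * (‖R z‖ * ‖z‖) := by
        rw [sq]; gcongr
      have e3 : (4 * (a + b) * ‖R z‖) * ‖z‖ ≤ ‖z‖ * ‖z‖ := by
        refine mul_le_mul_of_nonneg_right ?_ (norm_nonneg z)
        linarith [norm_nonneg (R z)]
      nlinarith
    exact (pow_le_pow_iff_left₀ (norm_nonneg _) (by positivity) two_ne_zero).1 h7
  let K : E →L[ℂ] E := K₀.mkContinuous (1 / 2) hK
  have hKn : ‖-K‖ < 1 := by
    rw [norm_neg]
    exact (LinearMap.mkContinuous_norm_le _ (by norm_num) _).trans_lt (by norm_num)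
  refine isSelfAdjoint_of_surjective (μ := μ) ?_ fun z => ?_
  · rintro ⟨x, hx⟩ ⟨y, hy⟩
    rw [LinearPMap.add_apply, LinearPMap.add_apply, inner_add_left, inner_add_right]
    exact congrArg₂ _ (hA ⟨x, hx.1⟩ ⟨y, hy.1⟩) (hB ⟨x, hx.2⟩ ⟨y, hy.2⟩)
  · let U := Units.oneSub (-K) hKn
    set w : E := (↑U⁻¹ : E →L[ℂ] E) z with hw
    have hUw : w + K w = z := by
      have h1 : (U : E →L[ℂ] E) * (↑U⁻¹ : E →L[ℂ] E) = 1 := U.mul_inv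
      have h2 := congrArg (fun T : E →L[ℂ] E => T z) h1
      simpa [U, sub_neg_eq_add, ← hw] using h2
    refine ⟨⟨R w, hRdom w, hdom (hRdom w)⟩, ?_⟩
    rw [LinearPMap.add_apply]
    change A ⟨R w, hRdom w⟩ + K w + (μ : ℂ) • R w = z
    rw [hRA, ← hUw]
    abel

end SelfAdjointness

/-! ### Regular solutions of the one-particle equation -/

theorem inner_graph_nonneg {E : Type u} [NormedAddCommGroup E] [InnerProductSpace ℂ E]
    {A : E →ₗ.[ℂ] E} (hA : IsPositiveOp A) : ∀ p ∈ A.graph, 0 ≤ (⟪p.1, p.2⟫_ℂ).re := by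
  intro p hp
  obtain ⟨x, hx, hx'⟩ := A.mem_graph_iff.1 hp
  rw [← hx, ← hx']
  exact hA x

section OneParticle

variable {H : Type u} [NormedAddCommGroup H] [InnerProductSpace ℂ H] [CompleteSpace H]

theorem inner_graph_of_isSelfAdjoint {M : H →ₗ.[ℂ] H} (hM : IsSelfAdjoint M) :
    ∀ p ∈ M.graph, ∀ q ∈ M.graph, ⟪p.2, q.1⟫_ℂ = ⟪p.1, q.2⟫_ℂ := by
  rw [← isFormalAdjoint_iff_graph]
  have h := LinearPMap.adjoint_isFormalAdjoint hM.dense_domain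
  rwa [LinearPMap.isSelfAdjoint_def.1 hM] at h

/-- The resolvent `(M + 1)⁻¹` of a positive self-adjoint operator. -/
theorem exists_resolvent_of_isSelfAdjoint {M : H →ₗ.[ℂ] H} (hM : IsSelfAdjoint M)
    (hMpos : IsPositiveOp M) : ∃ R : H →L[ℂ] H, ∀ z, (R z, z - R z) ∈ M.graph := by
  have hcl : M.graph.topologicalClosure = M.graph :=
    IsClosed.submodule_topologicalClosure_eq hM.isClosed
  have h := exists_resolvent M.graph (inner_graph_nonneg hMpos) one_pos (fun ψ hψ => ?_)
  · rw [hcl] at h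
    simpa using h
  · have h1 : ∀ x : M.domain, ⟪-ψ, (x : H)⟫_ℂ = ⟪ψ, M x⟫_ℂ := by
      intro x
      have := hψ _ (M.mem_graph x)
      simp only [Complex.ofReal_one, one_smul, inner_add_right] at this
      rw [inner_neg_left]
      linear_combination -this
    have h2 : ψ ∈ M.adjoint.domain := LinearPMap.mem_adjoint_domain_of_exists ψ ⟨-ψ, h1⟩
    have h3 : M.adjoint ⟨ψ, h2⟩ = -ψ := LinearPMap.adjoint_apply_eq hM.dense_domain _ h1
    have h4 : (ψ, -ψ) ∈ M.adjoint.graph := by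
      rw [← h3]; exact M.adjoint.mem_graph ⟨ψ, h2⟩
    rw [LinearPMap.isSelfAdjoint_def.1 hM] at h4
    have h5 := inner_graph_nonneg hMpos _ h4
    simp only [inner_neg_right, Complex.neg_re] at h5
    have h6 : (⟪ψ, ψ⟫_ℂ).re = ‖ψ‖ ^ 2 := inner_self_eq_norm_sq (𝕜 := ℂ) ψ
    have h7 : ‖ψ‖ ^ 2 = 0 := le_antisymm (by linarith) (sq_nonneg _)
    exact norm_eq_zero.1 (pow_eq_zero_iff two_ne_zero |>.1 h7)

/-- The cut-off `r ↦ 1 / r - 1`: the operator `M = R⁻¹ - 1`, bounded by cutting off small `r`. -/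
def cutInv (ε r : ℝ) : ℝ := r / max (r ^ 2) (ε ^ 2) - 1

/-- A cut-off function vanishing for `|r| ≤ ε`, where `cutInv ε r` differs from `1 / r - 1`. -/
def cutOne (ε r : ℝ) : ℝ := max (r ^ 2 - ε ^ 2) 0 / max (r ^ 2) (ε ^ 2)

theorem continuous_cutInv {ε : ℝ} (hε : 0 < ε) : Continuous (cutInv ε) := by
  unfold cutInv
  refine (Continuous.div (by fun_prop) (by fun_prop) fun r => ?_).sub continuous_const
  exact (lt_max_of_lt_right (by positivity)).ne'

theorem continuous_cutOne {ε : ℝ} (hε : 0 < ε) : Continuous (cutOne ε) := by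
  unfold cutOne
  refine Continuous.div (by fun_prop) (by fun_prop) fun r => ?_
  exact (lt_max_of_lt_right (by positivity)).ne'

theorem cutInv_mul_cutOne {ε : ℝ} (hε : 0 < ε) (r : ℝ) :
    cutInv ε r * (r * cutOne ε r) = cutOne ε r - r * cutOne ε r := by
  rcases le_total (ε ^ 2) (r ^ 2) with h | h
  · have hr : r ^ 2 ≠ 0 := (lt_of_lt_of_le (by positivity) h).ne'
    have hr' : r ≠ 0 := fun h0 => hr (by simp [h0])
    rw [cutInv, max_eq_left h]
    field_simp
  · have : cutOne ε r = 0 := by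
      rw [cutOne, max_eq_right (a := r ^ 2 - ε ^ 2) (by linarith), zero_div]
    simp [this]

theorem abs_sub_mul_cutOne_le {ε : ℝ} (hε : 0 < ε) (r : ℝ) : |r - r * cutOne ε r| ≤ ε := by
  rcases le_total (ε ^ 2) (r ^ 2) with h | h
  · have hr : 0 < r ^ 2 := lt_of_lt_of_le (by positivity) h
    have hr' : r ≠ 0 := fun h0 => hr.ne' (by simp [h0])
    have h1 : r - r * cutOne ε r = ε ^ 2 / r := by
      rw [cutOne, max_eq_left h, max_eq_left (by linarith)]
      field_simp
      ring
    have h2 : ε ≤ |r| := by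
      rw [← abs_of_pos hε]; exact sq_le_sq.1 h
    rw [h1, abs_div, abs_of_pos (by positivity : 0 < ε ^ 2), div_le_iff₀ (by positivity), sq]
    gcongr
  · have h1 : cutOne ε r = 0 := by
      rw [cutOne, max_eq_right (a := r ^ 2 - ε ^ 2) (by linarith), zero_div]
    rw [h1, mul_zero, sub_zero, ← abs_of_pos hε]
    exact sq_le_sq.1 h

/-- For a dense set of initial values `f`, the equation `F' = -M F` has a bounded solution `F` with
values in the domain of `M`. These `f` lie in spectral subspaces of `M` on which `M` is bounded,
obtained from the continuous functional calculus of the resolvent. -/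
theorem exists_dense_flow {M : H →ₗ.[ℂ] H} (hM : IsSelfAdjoint M) (hMpos : IsPositiveOp M) :
    ∃ D : Set H, Dense D ∧ ∀ f ∈ D, ∃ F G : ℝ → H, F 0 = f ∧ (∀ s, (F s, G s) ∈ M.graph) ∧
      (∀ s, HasDerivAt F (-G s) s) ∧ ∀ s, 0 ≤ s → ‖F s‖ ≤ ‖f‖ := by
  obtain ⟨R, hR⟩ := exists_resolvent_of_isSelfAdjoint hM hMpos
  have hsym := inner_graph_of_isSelfAdjoint hM
  have hRsa : IsSelfAdjoint R := by
    rw [ContinuousLinearMap.isSelfAdjoint_iff_isSymmetric]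
    intro x y
    have h := hsym _ (hR x) _ (hR y)
    simp only [inner_sub_left, inner_sub_right] at h
    change ⟪R x, y⟫_ℂ = ⟪x, R y⟫_ℂ
    linear_combination -h
  have hRdense : DenseRange R := by
    refine hM.dense_domain.mono ?_
    intro x hx
    have h1 := M.mem_graph ⟨x, hx⟩
    set y := M ⟨x, hx⟩
    have h2 := M.graph.sub_mem (hR (x + y)) h1
    have h3 := inner_graph_nonneg hMpos _ h2
    have h4 : ((R (x + y), x + y - R (x + y)) - (x, y)).2 = -(R (x + y) - x) := by
      simp only [Prod.snd_sub]; abel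
    rw [h4, inner_neg_right, Complex.neg_re] at h3
    have h6 : (⟪R (x + y) - x, R (x + y) - x⟫_ℂ).re = ‖R (x + y) - x‖ ^ 2 :=
      inner_self_eq_norm_sq (𝕜 := ℂ) _
    have h7 : ‖R (x + y) - x‖ ^ 2 = 0 := by
      refine le_antisymm ?_ (sq_nonneg _)
      have : 0 ≤ -(⟪R (x + y) - x, R (x + y) - x⟫_ℂ).re := h3
      linarith
    exact ⟨x + y, sub_eq_zero.1 (norm_eq_zero.1 (pow_eq_zero_iff two_ne_zero |>.1 h7))⟩
  refine ⟨{f | ∃ ε : ℝ, 0 < ε ∧ ∃ x, f = R (cfc (cutOne ε) R x)}, ?_, ?_⟩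
  · intro y
    rw [Metric.mem_closure_iff]
    intro δ hδ
    obtain ⟨x, hx⟩ := hRdense.exists_dist_lt y (half_pos hδ)
    set ε := δ / 2 / (‖x‖ + 1) with hε
    have hε0 : 0 < ε := by positivity
    refine ⟨R (cfc (cutOne ε) R x), ⟨ε, hε0, x, rfl⟩, ?_⟩
    have hc := continuous_cutOne hε0
    have h1 : R - R * cfc (cutOne ε) R = cfc (fun r => r - r * cutOne ε r) R := by
      rw [cfc_sub (fun r => r) (fun r => r * cutOne ε r) R (by fun_prop) (by fun_prop),
        cfc_mul (fun r => r) (cutOne ε) R (by fun_prop) hc.continuousOn, cfc_id' ℝ R]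
    have h2 : ‖R - R * cfc (cutOne ε) R‖ ≤ ε := by
      rw [h1]
      exact norm_cfc_le hε0.le fun r _ => abs_sub_mul_cutOne_le hε0 r
    have h3 : dist (R x) (R (cfc (cutOne ε) R x)) ≤ ε * ‖x‖ := by
      rw [dist_eq_norm]
      exact (R - R * cfc (cutOne ε) R).le_of_opNorm_le h2 x
    have h4 : ε * ‖x‖ ≤ δ / 2 := by
      rw [hε, div_mul_eq_mul_div, div_le_iff₀ (by positivity)]
      nlinarith [norm_nonneg x]
    calc dist y _ ≤ dist y (R x) + dist (R x) _ := dist_triangle _ _ _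
      _ < δ := by linarith
  · rintro f ⟨ε, hε, x, rfl⟩
    have hc := continuous_cutOne hε
    have hi := continuous_cutInv hε
    set A : H →L[ℂ] H := cfc (cutInv ε) R with hA
    set C : H →L[ℂ] H := cfc (cutOne ε) R with hC
    have hRA : Commute R A := (Commute.refl R).cfc_real (cutInv ε) |>.symm
    have hAC : Commute A C := cfc_commute_cfc _ _ _
    have hrel : A * (R * C) = C - R * C := by
      have e1 : R * C = cfc (fun r => r * cutOne ε r) R := by
        rw [cfc_mul (fun r => r) (cutOne ε) R (by fun_prop) hc.continuousOn, cfc_id' ℝ R]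
      rw [e1, hA, hC, ← cfc_mul (cutInv ε) (fun r => r * cutOne ε r) R hi.continuousOn
        (by fun_prop), ← cfc_sub (cutOne ε) (fun r => r * cutOne ε r) R hc.continuousOn
        (by fun_prop)]
      congr 1
      exact funext fun r => cutInv_mul_cutOne hε r
    have hgraph : ∀ y, (R (C y), A (R (C y))) ∈ M.graph := by
      intro y
      have h1 : A (R (C y)) = C y - R (C y) := congrArg (fun T : H →L[ℂ] H => T y) hrel
      rw [h1]
      exact hR (C y)
    let U : ℝ → H →L[ℂ] H := fun s => NormedSpace.exp (s • (-A))
    have hUd : ∀ s, HasDerivAt U (U s * (-A)) s := fun s => hasDerivAt_exp_smul_const (-A) s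
    have hcomm : ∀ (T : H →L[ℂ] H), Commute T A → ∀ s y, U s (T y) = T (U s y) := by
      intro T hT s y
      have h1 : Commute T (U s) := ((hT.neg_right).smul_right s).exp_right
      exact congrArg (fun T : H →L[ℂ] H => T y) h1.eq.symm
    have hF : ∀ s, U s (R (C x)) = R (C (U s x)) := by
      intro s
      rw [hcomm R hRA, hcomm C hAC.symm]
    have hder : ∀ s, HasDerivAt (fun s => U s (R (C x))) (-A (U s (R (C x)))) s := by
      intro s
      have h1 := (((ContinuousLinearMap.apply ℂ H (R (C x))).restrictScalars ℝ).hasFDerivAt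
        (x := U s)).comp_hasDerivAt s (hUd s)
      refine h1.congr_deriv ?_
      rw [← hcomm A (Commute.refl A)]
      simp
    have hg : ∀ s, (U s (R (C x)), A (U s (R (C x)))) ∈ M.graph := fun s => by
      rw [hF]; exact hgraph _
    have hU0 : U 0 (R (C x)) = R (C x) := by simp [U]
    refine ⟨fun s => U s (R (C x)), fun s => A (U s (R (C x))), hU0, hg, hder, fun s hs => ?_⟩
    have hsq : ∀ s, HasDerivAt (fun s => ‖U s (R (C x))‖ ^ 2)
        (2 * (⟪U s (R (C x)), -A (U s (R (C x)))⟫_ℂ).re) s := by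
      intro s
      have h1 := (hder s).inner ℂ (hder s)
      have h2 := (Complex.reCLM.hasFDerivAt).comp_hasDerivAt s h1
      have h3 : (fun s => ‖U s (R (C x))‖ ^ 2) =
          (⇑Complex.reCLM ∘ fun t => ⟪U t (R (C x)), U t (R (C x))⟫_ℂ) :=
        funext fun t => (inner_self_eq_norm_sq (𝕜 := ℂ) (U t (R (C x)))).symm
      rw [h3]
      refine h2.congr_deriv ?_
      rw [Complex.reCLM_apply, Complex.add_re, two_mul, ← inner_conj_symm (-A _),
        Complex.conj_re]
    have hanti : Antitone fun s => ‖U s (R (C x))‖ ^ 2 := by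
      refine antitone_of_hasDerivAt_nonpos hsq fun s => ?_
      have := inner_graph_nonneg hMpos _ (hg s)
      rw [inner_neg_right, Complex.neg_re]
      simp only at this
      change 2 * _ ≤ (0 : ℝ)
      linarith
    have := hanti hs
    simp only [hU0] at this
    exact (pow_le_pow_iff_left₀ (norm_nonneg _) (norm_nonneg _) two_ne_zero).1 this

end OneParticle

/-! ### The second quantization of a positive operator -/

section Kernels

open scoped ComplexOrder Matrix

variable {E : Type u} [NormedAddCommGroup E] [InnerProductSpace ℂ E] {ι : Type*}

theorem finsupp_sum_smul_smul (c : ι →₀ ℂ) (κ : ℂ) (x : ι → E) :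
    (c.sum fun i a => a • (κ • x i)) = κ • c.sum fun i a => a • x i := by
  simp only [Finsupp.sum, Finset.smul_sum]
  exact Finset.sum_congr rfl fun i _ => smul_comm _ _ _

theorem posSemidef_congr {A B : Matrix ι ι ℂ} (hA : A.PosSemidef) (h : ∀ i j, A i j = B i j) :
    B.PosSemidef :=
  (Matrix.ext h : A = B) ▸ hA

theorem inner_finsupp_sum (c : ι →₀ ℂ) (x y : ι → E) :
    ⟪c.sum fun i a => a • x i, c.sum fun j b => b • y j⟫_ℂ =
      c.sum fun i a => c.sum fun j b => star a * ⟪x i, y j⟫_ℂ * b := by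
  rw [Finsupp.sum_inner]
  refine Finsupp.sum_congr fun i _ => ?_
  rw [Finsupp.inner_sum]
  refine Finsupp.sum_congr fun j _ => ?_
  rw [inner_smul_left, inner_smul_right, starRingEnd_apply]
  ring

/-- Comparison of two kernels `(x i | y j)` and `(x' i | y' j)` whose difference is positive
semidefinite. -/
theorem re_inner_le_of_posSemidef {x y x' y' : ι → E}
    (h : (Matrix.of fun i j => ⟪x i, y j⟫_ℂ - ⟪x' i, y' j⟫_ℂ).PosSemidef) (c : ι →₀ ℂ) :
    (⟪c.sum fun i a => a • x' i, c.sum fun j b => b • y' j⟫_ℂ).re ≤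
      (⟪c.sum fun i a => a • x i, c.sum fun j b => b • y j⟫_ℂ).re := by
  have h1 := (Complex.le_def.1 (h.2 c)).1
  rw [← sub_nonneg, ← Complex.sub_re, inner_finsupp_sum, inner_finsupp_sum]
  refine h1.trans_eq ?_
  simp only [Finsupp.sum, Matrix.of_apply, mul_sub, sub_mul, Finset.sum_sub_distrib]

theorem posSemidef_inner (x : ι → E) : (Matrix.of fun i j => ⟪x i, x j⟫_ℂ).PosSemidef := by
  refine ⟨Matrix.IsHermitian.ext fun i j => inner_conj_symm _ _, fun c => ?_⟩
  have h := inner_finsupp_sum c x x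
  rw [inner_self_eq_norm_sq_to_K] at h
  refine le_of_le_of_eq ?_ h
  have h1 := Complex.zero_le_real.2 (sq_nonneg ‖c.sum fun i a => a • x i‖)
  rw [Complex.ofReal_pow] at h1
  exact h1

/-- The kernel `(f | T g)` of a symmetric positive operator is positive semidefinite. -/
theorem posSemidef_of_symmetric (D : Submodule ℂ E) (T : D →ₗ[ℂ] E)
    (hsym : ∀ f g : D, ⟪T f, (g : E)⟫_ℂ = ⟪(f : E), T g⟫_ℂ)
    (hpos : ∀ f : D, 0 ≤ (⟪(f : E), T f⟫_ℂ).re) :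
    (Matrix.of fun f g : D => ⟪(f : E), T g⟫_ℂ).PosSemidef := by
  refine ⟨Matrix.IsHermitian.ext fun f g => ?_, fun c => ?_⟩
  · rw [Matrix.of_apply, Matrix.of_apply, ← hsym g f]
    exact inner_conj_symm _ _
  · have h := inner_finsupp_sum c (fun f : D => (f : E)) (fun f => T f)
    set F : D := c.sum fun f a => a • f with hF
    have h1 : (c.sum fun (f : D) a => a • (f : E)) = F := by
      simp only [hF, Finsupp.sum, Submodule.coe_sum, Submodule.coe_smul]
    have h2 : (c.sum fun (f : D) a => a • T f) = T F := by
      simp only [hF, Finsupp.sum, map_sum, map_smul]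
    rw [h1, h2] at h
    refine le_of_le_of_eq (Complex.le_def.2 ⟨hpos F, ?_⟩) h
    have h3 := congrArg Complex.im (inner_conj_symm (F : E) (T F))
    rw [Complex.conj_im, hsym] at h3
    simp only [Complex.zero_im]
    linarith

end Kernels

section Core

variable {H : Type u} [NormedAddCommGroup H] [InnerProductSpace ℂ H]

/-- The graph of `dΓ(M)` on the span of the exponential vectors `exp f`, `f ∈ D(M)`. -/
def dGammaCore (M : H →ₗ.[ℂ] H) : Submodule ℂ (Fock H × Fock H) :=
  Submodule.span ℂ (Set.range fun f : M.domain => (expVec (f : H), circExp (M f) (f : H)))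

theorem mem_dGammaCore {M : H →ₗ.[ℂ] H} {p : Fock H × Fock H} (hp : p ∈ dGammaCore M) :
    ∃ c : M.domain →₀ ℂ, p = (c.sum fun f a => a • expVec (f : H),
      c.sum fun f a => a • circExp (M f) (f : H)) := by
  obtain ⟨c, rfl⟩ := Finsupp.mem_span_range_iff_exists_finsupp.1 hp
  refine ⟨c, Prod.ext ?_ ?_⟩
  · simp only [Finsupp.sum, Prod.fst_sum, Prod.smul_fst]
  · simp only [Finsupp.sum, Prod.snd_sum, Prod.smul_snd]

variable {M : H →ₗ.[ℂ] H}

theorem expVec_mem_dGammaCore (f : M.domain) :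
    (expVec (f : H), circExp (M f) (f : H)) ∈ dGammaCore M :=
  Submodule.subset_span ⟨f, rfl⟩

variable [CompleteSpace H]

theorem inner_dGammaCore (hM : IsSelfAdjoint M) :
    ∀ p ∈ dGammaCore M, ∀ q ∈ dGammaCore M, ⟪p.2, q.1⟫_ℂ = ⟪p.1, q.2⟫_ℂ := by
  intro p hp q hq
  unfold dGammaCore at hp hq
  induction hp, hq using Submodule.span_induction₂ with
  | mem_mem x y hx hy =>
    obtain ⟨f, rfl⟩ := hx
    obtain ⟨g, rfl⟩ := hy
    simp only
    rw [inner_circExp_expVec, inner_expVec_circExp,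
      inner_graph_of_isSelfAdjoint hM _ (M.mem_graph f) _ (M.mem_graph g)]
  | zero_left y hy => simp
  | zero_right x hx => simp
  | add_left x y z _ _ _ h1 h2 => simp only [Prod.fst_add, Prod.snd_add, inner_add_left, h1, h2]
  | add_right x y z _ _ _ h1 h2 => simp only [Prod.fst_add, Prod.snd_add, inner_add_right, h1, h2]
  | smul_left r x y _ _ h => simp only [Prod.smul_fst, Prod.smul_snd, inner_smul_left, h]
  | smul_right r x y _ _ h => simp only [Prod.smul_fst, Prod.smul_snd, inner_smul_right, h]

theorem eq_zero_of_inner_dGammaCore (hM : IsSelfAdjoint M) {ψ : Fock H}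
    (h : ∀ q ∈ dGammaCore M, ⟪ψ, q.1⟫_ℂ = 0) : ψ = 0 := by
  refine eq_zero_of_inner_expVec_dense hM.dense_domain fun f hf => ?_
  have h1 := h _ (expVec_mem_dGammaCore ⟨f, hf⟩)
  exact h1

theorem graph_dGamma (hM : IsSelfAdjoint M) :
    (dGamma M).graph = (dGammaCore M).topologicalClosure := by
  refine graph_closure_toLinearPMap _ ?_
  refine snd_eq_zero_of_formalAdjoint (g' := dGammaCore M) (fun p hp q hq => ?_)
    fun ψ hψ => eq_zero_of_inner_dGammaCore hM hψ
  exact formalAdjoint_topologicalClosure (inner_dGammaCore hM) p hp q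
    (Submodule.le_topologicalClosure _ hq)

theorem isFormalAdjoint_dGamma (hM : IsSelfAdjoint M) :
    (dGamma M).IsFormalAdjoint (dGamma M) := by
  rw [isFormalAdjoint_iff_graph, graph_dGamma hM]
  exact formalAdjoint_topologicalClosure (inner_dGammaCore hM)

/-- The range of `dΓ(M) + μ` on the core is dense: a vector `ψ` orthogonal to it satisfies
`u' = μ u` for `u s = (ψ | exp (F s))` and every solution of `F' = -M F`. A bounded such `F` gives a
bounded `u`, so that `u 0 = 0`. -/
theorem eq_zero_of_inner_dGammaCore_add (hM : IsSelfAdjoint M) (hMpos : IsPositiveOp M) {μ : ℝ}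
    (hμ : 0 < μ) {ψ : Fock H}
    (h : ∀ p ∈ dGammaCore M, ⟪ψ, p.2 + (μ : ℂ) • p.1⟫_ℂ = 0) : ψ = 0 := by
  obtain ⟨D, hD, hflow⟩ := exists_dense_flow hM hMpos
  refine eq_zero_of_inner_expVec_dense hD fun f hf => ?_
  obtain ⟨F, G, hF0, hFG, hF', hbd⟩ := hflow f hf
  have hu : ∀ s, HasDerivAt (fun s => ⟪ψ, expVec (F s)⟫_ℂ) (μ * ⟪ψ, expVec (F s)⟫_ℂ) s := by
    intro s
    have h1 := ((hasFDerivAt_expVec (F s)).restrictScalars ℝ).comp_hasDerivAt s (hF' s)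
    have h2 := (((innerSL ℂ ψ).restrictScalars ℝ).hasFDerivAt).comp_hasDerivAt s h1
    refine h2.congr_deriv ?_
    change ⟪ψ, fderiv ℂ expVec (F s) (-G s)⟫_ℂ = _
    rw [map_neg, fderiv_expVec, inner_neg_right]
    have hmem : F s ∈ M.domain := LinearPMap.mem_domain_of_mem_graph (hFG s)
    have hG : G s = M ⟨F s, hmem⟩ := LinearPMap.image_iff hmem |>.2 (hFG s)
    have h3 := h _ (expVec_mem_dGammaCore ⟨F s, hmem⟩)
    simp only [inner_add_right, inner_smul_right] at h3
    rw [hG]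
    linear_combination -h3
  have hw : ∀ s, HasDerivAt (fun s => Real.exp (-μ * s) • ⟪ψ, expVec (F s)⟫_ℂ) 0 s := by
    intro s
    have h1 : HasDerivAt (fun s => Real.exp (-μ * s)) (Real.exp (-μ * s) * (-μ * 1)) s :=
      ((hasDerivAt_id s).const_mul (-μ)).exp
    refine (h1.smul (hu s)).congr_deriv ?_
    simp only [Complex.real_smul]
    push_cast
    ring
  have hconst : ∀ s, Real.exp (-μ * s) • ⟪ψ, expVec (F s)⟫_ℂ = ⟪ψ, expVec f⟫_ℂ := by
    intro s
    have := is_const_of_deriv_eq_zero (fun s => (hw s).differentiableAt)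
      (fun s => (hw s).deriv) s 0
    simpa [hF0] using this
  have hle : ∀ s, 0 ≤ s → ‖⟪ψ, expVec f⟫_ℂ‖ ≤ Real.exp (-μ * s) * (‖ψ‖ * ‖expVec f‖) := by
    intro s hs
    rw [← hconst s, norm_smul, Real.norm_of_nonneg (Real.exp_pos _).le]
    have h1 : ‖expVec (F s)‖ ≤ ‖expVec f‖ := by
      refine (pow_le_pow_iff_left₀ (norm_nonneg _) (norm_nonneg _) two_ne_zero).1 ?_
      rw [norm_expVec_sq, norm_expVec_sq]
      have := hbd s hs
      gcongr
    gcongr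
    exact (norm_inner_le_norm _ _).trans (by gcongr)
  have hlim : Filter.Tendsto (fun s => Real.exp (-μ * s) * (‖ψ‖ * ‖expVec f‖)) Filter.atTop
      (nhds 0) := by
    have h1 : Filter.Tendsto (fun s : ℝ => -μ * s) Filter.atTop Filter.atBot :=
      Filter.tendsto_id.const_mul_atTop_of_neg (neg_lt_zero.2 hμ)
    simpa using (Real.tendsto_exp_atBot.comp h1).mul_const (‖ψ‖ * ‖expVec f‖)
  have := ge_of_tendsto hlim (Filter.eventually_atTop.2 ⟨0, hle⟩)
  exact norm_le_zero_iff.1 this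

end Core

section Bounds

open scoped ComplexOrder Matrix

variable {H : Type u} [NormedAddCommGroup H] [InnerProductSpace ℂ H] {M : H →ₗ.[ℂ] H}

theorem posSemidef_gram_expVec (D : Submodule ℂ H) :
    (Matrix.of fun f g : D => Complex.exp ⟪(f : H), (g : H)⟫_ℂ).PosSemidef := by
  have h := posSemidef_inner (fun f : D => expVec (f : H))
  exact posSemidef_congr h fun f g => inner_expVec _ _

variable [CompleteSpace H]

theorem posSemidef_inner_apply (hM : IsSelfAdjoint M) (hMpos : IsPositiveOp M) {κ : ℝ}
    (hκ : 0 ≤ κ) :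
    (Matrix.of fun f g : M.domain => (κ : ℂ) * ⟪(f : H), M g⟫_ℂ).PosSemidef := by
  have h := posSemidef_of_symmetric M.domain ((κ : ℂ) • M.toFun) (fun f g => ?_) (fun f => ?_)
  · exact posSemidef_congr h fun f g => inner_smul_right _ _ _
  · change ⟪(κ : ℂ) • M f, (g : H)⟫_ℂ = ⟪(f : H), (κ : ℂ) • M g⟫_ℂ
    rw [inner_smul_left, inner_smul_right, Complex.conj_ofReal,
      inner_graph_of_isSelfAdjoint hM _ (M.mem_graph f) _ (M.mem_graph g)]
  · change 0 ≤ (⟪(f : H), (κ : ℂ) • M f⟫_ℂ).re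
    rw [inner_smul_right, Complex.re_ofReal_mul]
    exact mul_nonneg hκ (hMpos f)

/-- The kernel of the positive quadratic form `κ (f | M f) - |(h | f)|²`. -/
theorem posSemidef_inner_apply_sub (hM : IsSelfAdjoint M) {h : H} {κ : ℝ}
    (hform : ∀ f : M.domain, ‖⟪h, (f : H)⟫_ℂ‖ ^ 2 ≤ κ * (⟪(f : H), M f⟫_ℂ).re) :
    (Matrix.of fun f g : M.domain =>
      (κ : ℂ) * ⟪(f : H), M g⟫_ℂ - ⟪(f : H), h⟫_ℂ * ⟪h, (g : H)⟫_ℂ).PosSemidef := by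
  let T : M.domain →ₗ[ℂ] H := (κ : ℂ) • M.toFun -
    ((innerSL ℂ h).toLinearMap.smulRight h).comp M.domain.subtype
  have hT : ∀ g, T g = (κ : ℂ) • M g - ⟪h, (g : H)⟫_ℂ • h := fun _ => rfl
  have hK : ∀ f g : M.domain, ⟪(f : H), T g⟫_ℂ =
      (κ : ℂ) * ⟪(f : H), M g⟫_ℂ - ⟪(f : H), h⟫_ℂ * ⟪h, (g : H)⟫_ℂ := fun f g => by
    rw [hT, inner_sub_right, inner_smul_right, inner_smul_right]; ring
  have h := posSemidef_of_symmetric M.domain T (fun f g => ?_) (fun f => ?_)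
  · exact posSemidef_congr h hK
  · rw [hK, hT, inner_sub_left, inner_smul_left, inner_smul_left, Complex.conj_ofReal,
      inner_conj_symm, inner_graph_of_isSelfAdjoint hM _ (M.mem_graph f) _ (M.mem_graph g)]
  · rw [hK, Complex.sub_re, Complex.re_ofReal_mul, ← inner_conj_symm (f : H) h, Complex.conj_mul']
    have := hform f
    rw [← Complex.ofReal_pow, Complex.ofReal_re]
    linarith

theorem inner_dGammaCore_nonneg (hM : IsSelfAdjoint M) (hMpos : IsPositiveOp M) :
    ∀ p ∈ dGammaCore M, 0 ≤ (⟪p.1, p.2⟫_ℂ).re := by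
  intro p hp
  obtain ⟨c, rfl⟩ := mem_dGammaCore hp
  have h := (posSemidef_inner_apply hM hMpos zero_le_one).hadamard
    (posSemidef_gram_expVec M.domain)
  have h2 := re_inner_le_of_posSemidef (x := fun f : M.domain => expVec (f : H))
    (y := fun f => circExp (M f) (f : H)) (x' := fun _ => 0) (y' := fun _ => 0) ?_ c
  · simpa using h2
  · refine posSemidef_congr h fun f g => ?_
    simp [inner_expVec_circExp]

/-- The bound `‖a(h) x‖² ≤ κ (x | dΓ(M) x)`. -/
theorem norm_annihilation_sq_le (hM : IsSelfAdjoint M) {h : H} {κ : ℝ}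
    (hform : ∀ f : M.domain, ‖⟪h, (f : H)⟫_ℂ‖ ^ 2 ≤ κ * (⟪(f : H), M f⟫_ℂ).re)
    (c : M.domain →₀ ℂ) :
    ‖c.sum fun f a => a • (⟪h, (f : H)⟫_ℂ • expVec (f : H))‖ ^ 2 ≤
      κ * (⟪c.sum fun f a => a • expVec (f : H),
        c.sum fun f a => a • circExp (M f) (f : H)⟫_ℂ).re := by
  have h1 := (posSemidef_inner_apply_sub hM hform).hadamard (posSemidef_gram_expVec M.domain)
  have h2 := re_inner_le_of_posSemidef (x := fun f : M.domain => (κ : ℂ) • expVec (f : H))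
    (y := fun f => circExp (M f) (f : H))
    (x' := fun f => ⟪h, (f : H)⟫_ℂ • expVec (f : H))
    (y' := fun f => ⟪h, (f : H)⟫_ℂ • expVec (f : H)) ?_ c
  · have h3 : (c.sum fun f a => a • ((κ : ℂ) • expVec (f : H))) =
        (κ : ℂ) • c.sum fun f a => a • expVec (f : H) := finsupp_sum_smul_smul _ _ _
    rw [h3, inner_smul_left, Complex.conj_ofReal, Complex.re_ofReal_mul] at h2
    refine le_trans (le_of_eq ?_) h2
    exact (inner_self_eq_norm_sq (𝕜 := ℂ) _).symm
  · refine posSemidef_congr h1 fun f g => ?_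
    simp only [Matrix.of_apply, Matrix.hadamard_apply, inner_smul_left, inner_smul_right,
      inner_expVec_circExp, inner_expVec, Complex.conj_ofReal, inner_conj_symm]
    ring

/-- The bound `‖a(h)² x‖ ≤ κ ‖dΓ(M) x‖`. With `Q = κ (f | M g)` and `P = Q - (f | h) (h | g)`, the
difference of the squares is the form of the kernel
`(κ² (M f | M g) + P Q + (f | h) (h | g) P) e ^ (f | g)`. -/
theorem norm_annihilation_annihilation_le (hM : IsSelfAdjoint M) (hMpos : IsPositiveOp M) {h : H}
    {κ : ℝ} (hκ : 0 ≤ κ)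
    (hform : ∀ f : M.domain, ‖⟪h, (f : H)⟫_ℂ‖ ^ 2 ≤ κ * (⟪(f : H), M f⟫_ℂ).re)
    (c : M.domain →₀ ℂ) :
    ‖c.sum fun f a => a • (⟪h, (f : H)⟫_ℂ ^ 2 • expVec (f : H))‖ ≤
      κ * ‖c.sum fun f a => a • circExp (M f) (f : H)‖ := by
  have hP := posSemidef_inner_apply_sub hM hform
  have hQ := posSemidef_inner_apply hM hMpos hκ
  have hh := posSemidef_inner (fun f : M.domain => ⟪h, (f : H)⟫_ℂ)
  have hN := posSemidef_inner (fun f : M.domain => (κ : ℂ) • M f)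
  have h1 := ((hN.add (hP.hadamard hQ)).add (hh.hadamard hP)).hadamard
    (posSemidef_gram_expVec M.domain)
  have h2 := re_inner_le_of_posSemidef
    (x := fun f : M.domain => (κ : ℂ) • circExp (M f) (f : H))
    (y := fun f : M.domain => (κ : ℂ) • circExp (M f) (f : H))
    (x' := fun f => ⟪h, (f : H)⟫_ℂ ^ 2 • expVec (f : H))
    (y' := fun f => ⟪h, (f : H)⟫_ℂ ^ 2 • expVec (f : H)) ?_ c
  · have h3 : (c.sum fun (f : M.domain) a => a • ((κ : ℂ) • circExp (M f) (f : H))) =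
        (κ : ℂ) • c.sum fun f a => a • circExp (M f) (f : H) := finsupp_sum_smul_smul _ _ _
    rw [h3] at h2
    have h4 : ‖c.sum fun f a => a • (⟪h, (f : H)⟫_ℂ ^ 2 • expVec (f : H))‖ ^ 2 ≤
        ‖(κ : ℂ) • c.sum fun f a => a • circExp (M f) (f : H)‖ ^ 2 := by
      refine le_trans (le_of_eq ?_) (h2.trans (le_of_eq ?_))
      · exact (inner_self_eq_norm_sq (𝕜 := ℂ) _).symm
      · exact inner_self_eq_norm_sq (𝕜 := ℂ) _
    have h5 := (pow_le_pow_iff_left₀ (norm_nonneg _) (norm_nonneg _) two_ne_zero).1 h4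
    rwa [norm_smul, Complex.norm_real, Real.norm_of_nonneg hκ] at h5
  · refine posSemidef_congr h1 fun f g => ?_
    have e1 := inner_graph_of_isSelfAdjoint hM _ (M.mem_graph f) _ (M.mem_graph g)
    simp only at e1
    simp only [Matrix.of_apply, Matrix.hadamard_apply, Matrix.add_apply,
      inner_smul_left, inner_smul_right, inner_circExp_circExp, inner_expVec, Complex.conj_ofReal,
      inner_conj_symm, map_pow, e1, RCLike.inner_apply]
    ring

end Bounds

/-! ### Creation, annihilation and field operators -/

section FieldOperator

/-- A closed subspace that contains a differentiable curve contains its derivative. -/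
theorem mem_of_hasDerivAt {E : Type*} [NormedAddCommGroup E] [NormedSpace ℂ E]
    (W : Submodule ℂ (E × E × E)) (hW : IsClosed (W : Set (E × E × E))) {γ₁ γ₂ γ₃ : ℂ → E}
    {v₁ v₂ v₃ : E} (h₁ : HasDerivAt γ₁ v₁ 0) (h₂ : HasDerivAt γ₂ v₂ 0) (h₃ : HasDerivAt γ₃ v₃ 0)
    (hmem : ∀ z, (γ₁ z, γ₂ z, γ₃ z) ∈ W) : (v₁, v₂, v₃) ∈ W := by
  have hγ := h₁.prodMk (h₂.prodMk h₃)
  rw [hasDerivAt_iff_tendsto_slope_zero] at hγ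
  exact hW.mem_of_tendsto hγ (Filter.Eventually.of_forall fun z =>
    W.smul_mem _ (W.sub_mem (hmem _) (hmem _)))

variable {H : Type u} [NormedAddCommGroup H] [InnerProductSpace ℂ H]

/-- The span of the triples `(exp f, a(h) exp f, a⁺(h) exp f)`. -/
def ladderCore (h : H) : Submodule ℂ (Fock H × Fock H × Fock H) :=
  Submodule.span ℂ
    (Set.range fun f : H => (expVec f, ⟪h, f⟫_ℂ • expVec f, circExp h f))

theorem expVec_mem_ladderCore (h f : H) :
    (expVec f, ⟪h, f⟫_ℂ • expVec f, circExp h f) ∈ ladderCore h :=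
  Submodule.subset_span ⟨f, rfl⟩

theorem inner_ladderCore (h : H) : ∀ p ∈ ladderCore h, ∀ q ∈ ladderCore h,
    ⟪p.2.2, q.1⟫_ℂ = ⟪p.1, q.2.1⟫_ℂ ∧
      ⟪p.2.2, q.2.2⟫_ℂ = ⟪p.2.1, q.2.1⟫_ℂ + ⟪h, h⟫_ℂ * ⟪p.1, q.1⟫_ℂ := by
  intro p hp q hq
  unfold ladderCore at hp hq
  induction hp, hq using Submodule.span_induction₂ with
  | mem_mem x y hx hy =>
    obtain ⟨f, rfl⟩ := hx
    obtain ⟨g, rfl⟩ := hy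
    simp only [inner_smul_left, inner_smul_right, inner_circExp_expVec, inner_circExp_circExp,
      inner_expVec, inner_conj_symm, true_and]
    ring
  | zero_left y hy => simp
  | zero_right x hx => simp
  | add_left x y z _ _ _ h1 h2 =>
    simp only [Prod.fst_add, Prod.snd_add, inner_add_left, h1, h2, true_and]; ring
  | add_right x y z _ _ _ h1 h2 =>
    simp only [Prod.fst_add, Prod.snd_add, inner_add_right, h1, h2, true_and]; ring
  | smul_left r x y _ _ h =>
    simp only [Prod.smul_fst, Prod.smul_snd, inner_smul_left, h, true_and]; ring
  | smul_right r x y _ _ h =>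
    simp only [Prod.smul_fst, Prod.smul_snd, inner_smul_right, h, true_and]; ring

/-- The closure of the span of the triples `(exp f, a(h) exp f, a⁺(h) exp f)`. -/
def ladder (h : H) : Submodule ℂ (Fock H × Fock H × Fock H) := (ladderCore h).topologicalClosure

theorem isClosed_ladder (h : H) : IsClosed (ladder h : Set (Fock H × Fock H × Fock H)) :=
  Submodule.isClosed_topologicalClosure _

theorem expVec_mem_ladder (h f : H) :
    (expVec f, ⟪h, f⟫_ℂ • expVec f, circExp h f) ∈ ladder h :=
  Submodule.le_topologicalClosure _ (expVec_mem_ladderCore h f)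

/-- The canonical commutation relation in the form `‖a⁺(h) x‖² = ‖a(h) x‖² + ‖h‖² ‖x‖²`. -/
theorem norm_sq_of_mem_ladder {h : H} {p : Fock H × Fock H × Fock H} (hp : p ∈ ladder h) :
    ‖p.2.2‖ ^ 2 = ‖p.2.1‖ ^ 2 + ‖h‖ ^ 2 * ‖p.1‖ ^ 2 := by
  refine closure_minimal
    (t := {p : Fock H × Fock H × Fock H | ‖p.2.2‖ ^ 2 = ‖p.2.1‖ ^ 2 + ‖h‖ ^ 2 * ‖p.1‖ ^ 2})
    (fun p hp => ?_) (isClosed_eq (by fun_prop) (by fun_prop)) hp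
  have h1 := (inner_ladderCore h p hp p hp).2
  simp only [inner_self_eq_norm_sq_to_K] at h1
  exact_mod_cast h1

theorem norm_le_of_mem_ladder {h : H} {p : Fock H × Fock H × Fock H} (hp : p ∈ ladder h) :
    ‖p.2.2‖ ≤ ‖p.2.1‖ + ‖h‖ * ‖p.1‖ := by
  have h1 := norm_sq_of_mem_ladder hp
  refine (pow_le_pow_iff_left₀ (norm_nonneg _) (by positivity) two_ne_zero).1 ?_
  have : 0 ≤ ‖p.2.1‖ * (‖h‖ * ‖p.1‖) := by positivity
  nlinarith

/-- The second derivative at the origin of `z ↦ exp (f + z h)`, the vector `h ∘ h ∘ exp f`. -/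
def circCircExp (h f : H) : Fock H := deriv (fun z : ℂ => circExp h (f + z • h)) 0

theorem hasDerivAt_circExp_line (h f : H) :
    HasDerivAt (fun z : ℂ => circExp h (f + z • h)) (circCircExp h f) 0 := by
  have h1 : (fun z : ℂ => circExp h (f + z • h)) = deriv fun z : ℂ => expVec (f + z • h) :=
    funext fun z => (hasDerivAt_expVec_line f h z).deriv.symm
  have h2 : Differentiable ℂ fun z : ℂ => expVec (f + z • h) :=
    fun z => (hasDerivAt_expVec_line f h z).differentiableAt
  refine DifferentiableAt.hasDerivAt ?_
  rw [h1]
  exact (h2.analyticAt 0).deriv.differentiableAt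

/-- The vector `h ∘ exp f` is in the domains of `a(h)` and `a⁺(h)`: it is the derivative of
`z ↦ exp (f + z h)`, and `a(h)` and `a⁺(h)` map this curve to differentiable curves. -/
theorem circExp_mem_ladder (h f : H) :
    (circExp h f, ⟪h, h⟫_ℂ • expVec f + ⟪h, f⟫_ℂ • circExp h f, circCircExp h f) ∈ ladder h := by
  have h1 := hasDerivAt_expVec_line f h 0
  rw [zero_smul, add_zero] at h1
  have h2 : HasDerivAt (fun z : ℂ => ⟪h, f + z • h⟫_ℂ) ⟪h, h⟫_ℂ 0 := by
    have : HasDerivAt (fun z : ℂ => ⟪h, f⟫_ℂ + z * ⟪h, h⟫_ℂ) (1 * ⟪h, h⟫_ℂ) 0 :=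
      ((hasDerivAt_id (0 : ℂ)).mul_const _).const_add _
    simpa [inner_add_right, inner_smul_right] using this
  have h3 := h2.smul h1
  simp only [zero_smul, add_zero] at h3
  rw [add_comm] at h3
  exact mem_of_hasDerivAt (ladder h) (isClosed_ladder h) h1 h3 (hasDerivAt_circExp_line h f)
    fun z => expVec_mem_ladder h (f + z • h)

theorem dense_of_expVec_mem {D : Submodule ℂ (Fock H)} (hD : ∀ f : H, expVec f ∈ D) :
    Dense (D : Set (Fock H)) := by
  rw [Submodule.dense_iff_topologicalClosure_eq_top,
    Submodule.topologicalClosure_eq_top_iff, Submodule.eq_bot_iff]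
  intro ψ hψ
  exact eq_zero_of_inner_expVec fun f => Submodule.mem_orthogonal' _ _ |>.1 hψ _ (hD f)

/-- The graph of `a⁺(h)` on the span of the exponential vectors. -/
def creationCore (h : H) : Submodule ℂ (Fock H × Fock H) :=
  Submodule.span ℂ (Set.range fun f : H => (expVec f, circExp h f))

/-- The graph of `a(h)` on the span of the exponential vectors. -/
def annihilationCore (h : H) : Submodule ℂ (Fock H × Fock H) :=
  Submodule.span ℂ (Set.range fun f : H => (expVec f, ⟪h, f⟫_ℂ • expVec f))

theorem expVec_mem_annihilationCore (h f : H) :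
    (expVec f, ⟪h, f⟫_ℂ • expVec f) ∈ annihilationCore h :=
  Submodule.subset_span ⟨f, rfl⟩

theorem expVec_mem_creationCore (h f : H) : (expVec f, circExp h f) ∈ creationCore h :=
  Submodule.subset_span ⟨f, rfl⟩

theorem inner_creationCore (h : H) :
    ∀ p ∈ creationCore h, ∀ q ∈ annihilationCore h, ⟪p.2, q.1⟫_ℂ = ⟪p.1, q.2⟫_ℂ := by
  intro p hp q hq
  unfold creationCore at hp
  unfold annihilationCore at hq
  induction hp, hq using Submodule.span_induction₂ with
  | mem_mem x y hx hy =>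
    obtain ⟨f, rfl⟩ := hx
    obtain ⟨g, rfl⟩ := hy
    simp only [inner_smul_right, inner_circExp_expVec, inner_expVec]
  | zero_left y hy => simp
  | zero_right x hx => simp
  | add_left x y z _ _ _ h1 h2 => simp only [Prod.fst_add, Prod.snd_add, inner_add_left, h1, h2]
  | add_right x y z _ _ _ h1 h2 => simp only [Prod.fst_add, Prod.snd_add, inner_add_right, h1, h2]
  | smul_left r x y _ _ h => simp only [Prod.smul_fst, Prod.smul_snd, inner_smul_left, h]
  | smul_right r x y _ _ h => simp only [Prod.smul_fst, Prod.smul_snd, inner_smul_right, h]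

theorem inner_creationCore_closure (h : H) :
    ∀ p ∈ (creationCore h).topologicalClosure, ∀ q ∈ (annihilationCore h).topologicalClosure,
      ⟪p.2, q.1⟫_ℂ = ⟪p.1, q.2⟫_ℂ :=
  formalAdjoint_topologicalClosure (inner_creationCore h)

theorem graph_creation (h : H) : (creation h).graph = (creationCore h).topologicalClosure := by
  refine graph_closure_toLinearPMap _ ?_
  refine snd_eq_zero_of_formalAdjoint (inner_creationCore_closure h) fun ψ hψ => ?_
  refine eq_zero_of_inner_expVec fun f => ?_
  have h1 := hψ _ (Submodule.le_topologicalClosure _ (expVec_mem_annihilationCore h f))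
  exact h1

theorem mem_topologicalClosure_of_map {E : Type*} [NormedAddCommGroup E] [NormedSpace ℂ E]
    {V : Submodule ℂ (E × E × E)} {g : Submodule ℂ (E × E)} (T : E × E × E →L[ℂ] E × E)
    (hV : ∀ p ∈ V, T p ∈ g) : ∀ p ∈ V.topologicalClosure, T p ∈ g.topologicalClosure := by
  intro p hp
  have h1 : V.topologicalClosure ≤ g.topologicalClosure.comap T.toLinearMap :=
    Submodule.topologicalClosure_minimal _ (fun p hp => g.le_topologicalClosure (hV p hp))
      ((Submodule.isClosed_topologicalClosure g).preimage T.continuous)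
  exact h1 hp

theorem ladderCore_le (h : H) (p : Fock H × Fock H × Fock H) (hp : p ∈ ladderCore h) :
    (p.1, p.2.1) ∈ annihilationCore h ∧ (p.1, p.2.2) ∈ creationCore h := by
  unfold ladderCore at hp
  induction hp using Submodule.span_induction with
  | mem x hx =>
    obtain ⟨f, rfl⟩ := hx
    exact ⟨expVec_mem_annihilationCore h f, expVec_mem_creationCore h f⟩
  | zero => exact ⟨Submodule.zero_mem _, Submodule.zero_mem _⟩
  | add x y _ _ h1 h2 =>
    exact ⟨Submodule.add_mem _ h1.1 h2.1, Submodule.add_mem _ h1.2 h2.2⟩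
  | smul r x _ h1 => exact ⟨Submodule.smul_mem _ r h1.1, Submodule.smul_mem _ r h1.2⟩

theorem mem_annihilationCore_of_mem_ladder {h : H} {p : Fock H × Fock H × Fock H}
    (hp : p ∈ ladder h) : (p.1, p.2.1) ∈ (annihilationCore h).topologicalClosure :=
  mem_topologicalClosure_of_map ((ContinuousLinearMap.fst ℂ _ _).prod
    ((ContinuousLinearMap.fst ℂ _ _).comp (ContinuousLinearMap.snd ℂ _ _)))
    (fun p hp => (ladderCore_le h p hp).1) p hp

theorem mem_graph_creation_of_mem_ladder {h : H} {p : Fock H × Fock H × Fock H}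
    (hp : p ∈ ladder h) : (p.1, p.2.2) ∈ (creation h).graph := by
  rw [graph_creation]
  exact mem_topologicalClosure_of_map ((ContinuousLinearMap.fst ℂ _ _).prod
    ((ContinuousLinearMap.snd ℂ _ _).comp (ContinuousLinearMap.snd ℂ _ _)))
    (fun p hp => (ladderCore_le h p hp).2) p hp

theorem dense_domain_creation (h : H) : Dense ((creation h).domain : Set (Fock H)) :=
  dense_of_expVec_mem fun f => LinearPMap.mem_domain_of_mem_graph
    (mem_graph_creation_of_mem_ladder (expVec_mem_ladder h f))

theorem mem_graph_annihilation_of_mem_ladder {h : H} {p : Fock H × Fock H × Fock H}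
    (hp : p ∈ ladder h) : (p.1, p.2.1) ∈ (annihilation h).graph := by
  rw [annihilation, LinearPMap.adjoint_graph_eq_graph_adjoint (dense_domain_creation h),
    Submodule.mem_adjoint_iff]
  intro a b hab
  rw [graph_creation] at hab
  rw [sub_eq_zero]
  exact inner_creationCore_closure h _ hab _ (mem_annihilationCore_of_mem_ladder hp)

theorem mem_graph_add {E : Type*} [AddCommGroup E] [Module ℂ E] {A B : E →ₗ.[ℂ] E} {x y z : E}
    (hA : (x, y) ∈ A.graph) (hB : (x, z) ∈ B.graph) : (x, y + z) ∈ (A + B).graph := by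
  have h1 := LinearPMap.mem_domain_of_mem_graph hA
  have h2 := LinearPMap.mem_domain_of_mem_graph hB
  rw [(LinearPMap.image_iff h1).2 hA, (LinearPMap.image_iff h2).2 hB]
  exact (A + B).mem_graph ⟨x, h1, h2⟩

theorem mem_graph_creation_add_annihilation {h : H} {p : Fock H × Fock H × Fock H}
    (hp : p ∈ ladder h) : (p.1, p.2.2 + p.2.1) ∈ (creation h + annihilation h).graph :=
  mem_graph_add (mem_graph_creation_of_mem_ladder hp) (mem_graph_annihilation_of_mem_ladder hp)

theorem mem_graph_field {h : H} {p : Fock H × Fock H × Fock H}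
    (hp : p ∈ ladder h) : (p.1, p.2.2 + p.2.1) ∈ (field h).graph :=
  LinearPMap.le_graph_of_le (LinearPMap.le_closure _) (mem_graph_creation_add_annihilation hp)

theorem inner_graph_creation_add_annihilation (h : H) :
    ∀ p ∈ (creation h + annihilation h).graph, ∀ q ∈ (creation h + annihilation h).graph,
      ⟪p.2, q.1⟫_ℂ = ⟪p.1, q.2⟫_ℂ := by
  rw [← isFormalAdjoint_iff_graph]
  have hadj := LinearPMap.adjoint_isFormalAdjoint (dense_domain_creation h)
  rintro ⟨x, hx⟩ ⟨y, hy⟩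
  rw [LinearPMap.add_apply, LinearPMap.add_apply, inner_add_left, inner_add_right, add_comm]
  exact congrArg₂ _ (hadj ⟨x, hx.2⟩ ⟨y, hy.1⟩) (hadj.symm ⟨x, hx.1⟩ ⟨y, hy.2⟩)

theorem graph_field (h : H) :
    (field h).graph = (creation h + annihilation h).graph.topologicalClosure := by
  have hfun : ∀ p ∈ (creation h + annihilation h).graph.topologicalClosure,
      p.1 = 0 → p.2 = 0 := by
    refine snd_eq_zero_of_formalAdjoint
      (formalAdjoint_topologicalClosure (inner_graph_creation_add_annihilation h)) fun ψ hψ => ?_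
    refine eq_zero_of_inner_expVec fun f => ?_
    have h1 := hψ _ (Submodule.le_topologicalClosure _
      (mem_graph_creation_add_annihilation (expVec_mem_ladder h f)))
    exact h1
  have hc : (creation h + annihilation h).IsClosable :=
    ⟨_, (Submodule.toLinearPMap_graph_eq _ hfun).symm⟩
  rw [field, ← hc.graph_closure_eq_closure_graph]

theorem inner_graph_field (h : H) :
    ∀ p ∈ (field h).graph, ∀ q ∈ (field h).graph, ⟪p.2, q.1⟫_ℂ = ⟪p.1, q.2⟫_ℂ := by
  rw [graph_field]
  exact formalAdjoint_topologicalClosure (inner_graph_creation_add_annihilation h)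

end FieldOperator

/-! ### Perturbation by the field operator -/

section Extension

variable {E : Type u} [NormedAddCommGroup E] [InnerProductSpace ℂ E] [CompleteSpace E]

/-- Bounds that hold for finite linear combinations of pairs `(x i, y i)` pass to the closure of
their span, together with the vectors that they control. -/
theorem exists_extension {ι : Type*} (x y p q : ι → E) (C : ℝ)
    (hC : ∀ c : ι →₀ ℂ, ∀ D : ℝ, ‖c.sum fun i a => a • x i‖ ≤ D → ‖c.sum fun i a => a • y i‖ ≤ D →
      ‖c.sum fun i a => a • p i‖ ≤ C * D ∧ ‖c.sum fun i a => a • q i‖ ≤ C * D)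
    {S : Set ((E × E) × (E × E))} (hS : IsClosed S)
    (hmem : ∀ c : ι →₀ ℂ, ((c.sum fun i a => a • x i, c.sum fun i a => a • y i),
      (c.sum fun i a => a • p i, c.sum fun i a => a • q i)) ∈ S)
    {z : E × E} (hz : z ∈ (Submodule.span ℂ (Set.range fun i => (x i, y i))).topologicalClosure) :
    ∃ w, (z, w) ∈ S := by
  set V : Submodule ℂ ((E × E) × (E × E)) :=
    Submodule.span ℂ (Set.range fun i => ((x i, y i), (p i, q i))) with hV
  have hrep : ∀ t ∈ V, ∃ c : ι →₀ ℂ, t = ((c.sum fun i a => a • x i, c.sum fun i a => a • y i),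
      (c.sum fun i a => a • p i, c.sum fun i a => a • q i)) := by
    intro t ht
    obtain ⟨c, rfl⟩ := Finsupp.mem_span_range_iff_exists_finsupp.1 ht
    refine ⟨c, ?_⟩
    refine Prod.ext (Prod.ext ?_ ?_) (Prod.ext ?_ ?_) <;>
    simp only [Finsupp.sum, Prod.fst_sum, Prod.snd_sum, Prod.smul_fst, Prod.smul_snd]
  have hmap : V.map (LinearMap.fst ℂ (E × E) (E × E)) =
      Submodule.span ℂ (Set.range fun i => (x i, y i)) := by
    rw [hV, Submodule.map_span, ← Set.range_comp]
    rfl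
  rw [← hmap] at hz
  obtain ⟨w, hw⟩ := exists_mem_topologicalClosure_of_bound V C (fun t ht => by
    obtain ⟨c, rfl⟩ := hrep t ht
    have h := hC c _ (le_max_left _ _) (le_max_right _ _)
    exact max_le h.1 h.2) hz
  refine ⟨w, closure_minimal (fun t ht => ?_) hS hw⟩
  obtain ⟨c, rfl⟩ := hrep t ht
  exact hmem c

/-- If `‖Φ x‖² ≤ a (x | A x) + b ‖x‖²`, then `A + t Φ` is self-adjoint on the domain of `A`. -/
theorem isSelfAdjoint_add_smul {A Φ : E →ₗ.[ℂ] E} (hA : A.IsFormalAdjoint A)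
    (hApos : IsPositiveOp A)
    (hres : ∀ μ : ℝ, 0 < μ → ∃ R : E →L[ℂ] E, ∀ z, (R z, z - (μ : ℂ) • R z) ∈ A.graph)
    (hΦ : ∀ p ∈ Φ.graph, ∀ q ∈ Φ.graph, ⟪p.2, q.1⟫_ℂ = ⟪p.1, q.2⟫_ℂ) {a b : ℝ} (ha : 0 ≤ a)
    (hb : 0 ≤ b)
    (hbd : ∀ z ∈ A.graph, ∃ p, (z.1, p) ∈ Φ.graph ∧
      ‖p‖ ^ 2 ≤ a * (⟪z.1, z.2⟫_ℂ).re + b * ‖z.1‖ ^ 2) (t : ℝ) :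
    (A + (t : ℂ) • Φ).domain = A.domain ∧ IsSelfAdjoint (A + (t : ℂ) • Φ) := by
  have hdom : A.domain ≤ Φ.domain := by
    intro x hx
    obtain ⟨p, hp, -⟩ := hbd _ (A.mem_graph ⟨x, hx⟩)
    exact LinearPMap.mem_domain_of_mem_graph hp
  refine ⟨inf_eq_left.2 hdom, isSelfAdjoint_add_of_form_bound hA hApos ?_ hdom hres
    (a := t ^ 2 * a) (b := t ^ 2 * b) (by positivity) (by positivity) fun z hz w hw => ?_⟩
  · intro x y
    change ⟪(t : ℂ) • Φ x, (y : E)⟫_ℂ = ⟪(x : E), (t : ℂ) • Φ y⟫_ℂ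
    rw [inner_smul_left, inner_smul_right, Complex.conj_ofReal,
      (isFormalAdjoint_iff_graph _ _).2 hΦ x y]
  · obtain ⟨p, hp, hpbd⟩ := hbd z hz
    have hwp : w = (t : ℂ) • p := by
      obtain ⟨x, hx, hx'⟩ := LinearPMap.mem_graph_iff _ |>.1 hw
      have h1 : ((x : E), Φ x) ∈ Φ.graph := Φ.mem_graph x
      have h2 : Φ x = p := Φ.mem_graph_snd_inj h1 hp hx
      rw [← h2]
      exact hx'.symm
    rw [hwp, norm_smul, Complex.norm_real, mul_pow, Real.norm_eq_abs, sq_abs]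
    calc t ^ 2 * ‖p‖ ^ 2 ≤ t ^ 2 * (a * (⟪z.1, z.2⟫_ℂ).re + b * ‖z.1‖ ^ 2) := by gcongr
      _ = _ := by ring

end Extension

/-- If the domain of `A` is contained in that of `Φ²` and `‖Φ x‖² ≤ (x | A x) + 2 η² ‖x‖²`, then
`A - Φ² / 2 ≥ -η²`, since `(x | Φ² x) = ‖Φ x‖²`. -/
theorem hasLowerBound_sub_half_opComp {E : Type u} [NormedAddCommGroup E] [InnerProductSpace ℂ E]
    {A Φ : E →ₗ.[ℂ] E} (hA : A.IsFormalAdjoint A) (hApos : IsPositiveOp A)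
    (hΦ : ∀ p ∈ Φ.graph, ∀ q ∈ Φ.graph, ⟪p.2, q.1⟫_ℂ = ⟪p.1, q.2⟫_ℂ) {η : ℝ}
    (hbd : ∀ z ∈ A.graph, ∃ p q, (z.1, p) ∈ Φ.graph ∧ (p, q) ∈ Φ.graph ∧
      ‖p‖ ^ 2 ≤ (⟪z.1, z.2⟫_ℂ).re + 2 * η ^ 2 * ‖z.1‖ ^ 2) :
    (A - (1 / 2 : ℂ) • opComp Φ Φ).domain = A.domain ∧
      HasLowerBound (A - (1 / 2 : ℂ) • opComp Φ Φ) (-η ^ 2) := by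
  have hdom : A.domain ≤ (opComp Φ Φ).domain := by
    intro x hx
    obtain ⟨p, q, hp, hq, -⟩ := hbd _ (A.mem_graph ⟨x, hx⟩)
    exact LinearPMap.mem_domain_of_mem_graph (mem_graph_opComp hp hq)
  have hsym : (opComp Φ Φ).IsFormalAdjoint (opComp Φ Φ) := by
    rw [isFormalAdjoint_iff_graph]
    rintro ⟨x, z⟩ hxz ⟨x', z'⟩ hxz'
    obtain ⟨y, hxy, hyz⟩ := mem_graph_opComp_iff.1 hxz
    obtain ⟨y', hxy', hyz'⟩ := mem_graph_opComp_iff.1 hxz'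
    exact (hΦ _ hyz _ hxy').trans (hΦ _ hxy _ hyz')
  refine ⟨inf_eq_left.2 hdom, ?_, ?_⟩
  · rintro ⟨x, hx⟩ ⟨y, hy⟩
    rw [LinearPMap.sub_apply, LinearPMap.sub_apply, inner_sub_left, inner_sub_right]
    refine congrArg₂ _ (hA ⟨x, hx.1⟩ ⟨y, hy.1⟩) ?_
    change ⟪(1 / 2 : ℂ) • opComp Φ Φ ⟨x, hx.2⟩, y⟫_ℂ = ⟪x, (1 / 2 : ℂ) • opComp Φ Φ ⟨y, hy.2⟩⟫_ℂ
    have h1 : ⟪opComp Φ Φ ⟨x, hx.2⟩, y⟫_ℂ = ⟪x, opComp Φ Φ ⟨y, hy.2⟩⟫_ℂ :=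
      hsym ⟨x, hx.2⟩ ⟨y, hy.2⟩
    have h2 : (starRingEnd ℂ) (1 / 2 : ℂ) = 1 / 2 := by
      rw [map_div₀, map_one, Complex.conj_ofNat]
    rw [inner_smul_left, inner_smul_right, h1, h2]
  · rintro ⟨x, hx⟩
    obtain ⟨p, q, hp, hq, hpbd⟩ := hbd _ (A.mem_graph ⟨x, hx.1⟩)
    have hval : opComp Φ Φ ⟨x, hx.2⟩ = q :=
      (opComp Φ Φ).mem_graph_snd_inj (LinearPMap.mem_graph (opComp Φ Φ) ⟨x, hx.2⟩)
        (mem_graph_opComp hp hq) rfl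
    rw [LinearPMap.sub_apply, inner_sub_right, Complex.sub_re]
    change -η ^ 2 * ‖x‖ ^ 2 ≤ (⟪x, A ⟨x, hx.1⟩⟫_ℂ).re -
      (⟪x, (1 / 2 : ℂ) • opComp Φ Φ ⟨x, hx.2⟩⟫_ℂ).re
    have h1 : (⟪x, (1 / 2 : ℂ) • q⟫_ℂ).re = 1 / 2 * ‖p‖ ^ 2 := by
      have h2 := hΦ _ hp _ hq
      simp only at h2
      have h3 : ((1 / 2 : ℝ) : ℂ) = (1 / 2 : ℂ) := by push_cast; rfl
      rw [inner_smul_right, ← h2, ← h3, Complex.re_ofReal_mul]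
      congr 1
      exact inner_self_eq_norm_sq (𝕜 := ℂ) p
    rw [hval, h1]
    have h4 := hApos ⟨x, hx.1⟩
    simp only at hpbd h4
    linarith

section FieldBounds

variable {H : Type u} [NormedAddCommGroup H] [InnerProductSpace ℂ H] [CompleteSpace H]
variable {M : H →ₗ.[ℂ] H}

/-- The domain of `dΓ(M)` is contained in the domain of `Φ(h)²`, and `Φ(h)²` is bounded by the form
of `dΓ(M)`, if `|(h | f)|² ≤ k² (f | M f)`. -/
theorem exists_field_field (hM : IsSelfAdjoint M) (hMpos : IsPositiveOp M) {h : H} {k : ℝ}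
    (hk : 0 ≤ k)
    (hform : ∀ f : M.domain, ‖⟪h, (f : H)⟫_ℂ‖ ^ 2 ≤ k ^ 2 * (⟪(f : H), M f⟫_ℂ).re)
    {z : Fock H × Fock H} (hz : z ∈ (dGamma M).graph) :
    ∃ p q, (z.1, p) ∈ (field h).graph ∧ (p, q) ∈ (field h).graph ∧
      ‖p‖ ^ 2 ≤ 4 * k ^ 2 * (⟪z.1, z.2⟫_ℂ).re + 2 * ‖h‖ ^ 2 * ‖z.1‖ ^ 2 := by
  set η := ‖h‖ with hη
  have hη0 : 0 ≤ η := norm_nonneg h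
  have hhh : ⟪h, h⟫_ℂ = ((η ^ 2 : ℝ) : ℂ) := by
    rw [inner_self_eq_norm_sq_to_K]; push_cast; rfl
  have hcl : IsClosed ((field h).graph : Set (Fock H × Fock H)) := by
    rw [graph_field]; exact Submodule.isClosed_topologicalClosure _
  -- `ladder h` is closed under the linear combinations formed below.
  have hlad : ∀ {ι : Type u} (c : ι →₀ ℂ) (x a b : ι → Fock H),
      (∀ i, (x i, a i, b i) ∈ ladder h) →
      ((c.sum fun i r => r • x i), (c.sum fun i r => r • a i), (c.sum fun i r => r • b i)) ∈
        ladder h := by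
    intro ι c x a b hi
    have h1 : (c.sum fun i r => r • (x i, a i, b i)) ∈ ladder h :=
      Submodule.sum_mem _ fun i _ => Submodule.smul_mem _ _ (hi i)
    have h2 : (c.sum fun i r => r • (x i, a i, b i)) =
        ((c.sum fun i r => r • x i), (c.sum fun i r => r • a i), (c.sum fun i r => r • b i)) := by
      refine Prod.ext ?_ (Prod.ext ?_ ?_) <;>
      simp only [Finsupp.sum, Prod.fst_sum, Prod.snd_sum, Prod.smul_fst, Prod.smul_snd]
    rwa [h2] at h1
  -- Each letter `a`, `b` in a name stands for a factor `a(h)`, `a⁺(h)` applied to `e f = exp f`.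
  let e : M.domain → Fock H := fun f => expVec (f : H)
  let y : M.domain → Fock H := fun f => circExp (M f) (f : H)
  let a : M.domain → Fock H := fun f => ⟪h, (f : H)⟫_ℂ • expVec (f : H)
  let aa : M.domain → Fock H := fun f => ⟪h, (f : H)⟫_ℂ ^ 2 • expVec (f : H)
  let b : M.domain → Fock H := fun f => circExp h (f : H)
  let ba : M.domain → Fock H := fun f => ⟪h, (f : H)⟫_ℂ • circExp h (f : H)
  let ab : M.domain → Fock H := fun f =>
    ⟪h, h⟫_ℂ • expVec (f : H) + ⟪h, (f : H)⟫_ℂ • circExp h (f : H)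
  let bb : M.domain → Fock H := fun f => circCircExp h (f : H)
  have l1 : ∀ f, (e f, a f, b f) ∈ ladder h := fun f => expVec_mem_ladder h f
  have l2 : ∀ f, (a f, aa f, ba f) ∈ ladder h := fun f => by
    have h1 := (ladder h).smul_mem ⟪h, (f : H)⟫_ℂ (l1 f)
    have h2 : aa f = ⟪h, (f : H)⟫_ℂ • a f := by simp only [aa, a, smul_smul, sq]
    rw [h2]
    exact h1
  have l3 : ∀ f, (b f, ab f, bb f) ∈ ladder h := fun f => circExp_mem_ladder h f
  let lc : (M.domain → Fock H) → (M.domain →₀ ℂ) → Fock H := fun x c => c.sum fun f r => r • x f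
  have hadd : ∀ (x x' : M.domain → Fock H) (c : M.domain →₀ ℂ),
      lc (fun f => x f + x' f) c = lc x c + lc x' c := by
    intro x x' c
    simp only [lc, Finsupp.sum, smul_add, Finset.sum_add_distrib]
  have m1 : ∀ c, (lc e c, lc a c, lc b c) ∈ ladder h := fun c => hlad c _ _ _ l1
  have m2 : ∀ c, (lc a c, lc aa c, lc ba c) ∈ ladder h := fun c => hlad c _ _ _ l2
  have m3 : ∀ c, (lc b c, lc ab c, lc bb c) ∈ ladder h := fun c => hlad c _ _ _ l3
  have hab : ∀ c, lc ab c = ((η ^ 2 : ℝ) : ℂ) • lc e c + lc ba c := by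
    intro c
    rw [← hhh]
    simp only [lc, ab, e, ba, Finsupp.sum, smul_add, Finset.sum_add_distrib, Finset.smul_sum]
    congr 1
    exact Finset.sum_congr rfl fun i _ => smul_comm _ _ _
  have hA : ∀ c, ‖lc a c‖ ^ 2 ≤ k ^ 2 * (⟪lc e c, lc y c⟫_ℂ).re := fun c =>
    norm_annihilation_sq_le hM hform c
  have hAA : ∀ c, ‖lc aa c‖ ≤ k ^ 2 * ‖lc y c‖ := fun c =>
    norm_annihilation_annihilation_le hM hMpos (sq_nonneg k) hform c
  rw [graph_dGamma hM] at hz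
  let S : Set ((Fock H × Fock H) × (Fock H × Fock H)) :=
    {t | (t.1.1, t.2.1) ∈ (field h).graph ∧ (t.2.1, t.2.2) ∈ (field h).graph ∧
      ‖t.2.1‖ ^ 2 ≤ 4 * k ^ 2 * (⟪t.1.1, t.1.2⟫_ℂ).re + 2 * η ^ 2 * ‖t.1.1‖ ^ 2}
  suffices hext : ∃ w, (z, w) ∈ S by
    obtain ⟨⟨p, q⟩, hpq⟩ := hext
    exact ⟨p, q, hpq.1, hpq.2.1, hpq.2.2⟩
  refine exists_extension e y (fun f => b f + a f) (fun f => (ba f + aa f) + (bb f + ab f))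
    ((2 * k + η) + 4 * (k ^ 2 + η * k + η ^ 2)) (fun c D hx hy => ?_) ?_ (fun c => ?_) hz
  · change ‖lc e c‖ ≤ D at hx
    change ‖lc y c‖ ≤ D at hy
    change ‖lc (fun f => b f + a f) c‖ ≤ _ ∧ ‖lc (fun f => (ba f + aa f) + (bb f + ab f)) c‖ ≤ _
    have hD : 0 ≤ D := (norm_nonneg _).trans hx
    have b1 : ‖lc a c‖ ≤ k * D := by
      refine (pow_le_pow_iff_left₀ (norm_nonneg _) (by positivity) two_ne_zero).1 ?_
      refine (hA c).trans ?_
      rw [mul_pow]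
      gcongr
      calc (⟪lc e c, lc y c⟫_ℂ).re ≤ ‖lc e c‖ * ‖lc y c‖ :=
            (Complex.re_le_norm _).trans (norm_inner_le_norm _ _)
        _ ≤ D * D := by gcongr
        _ = D ^ 2 := (sq D).symm
    have b2 : ‖lc aa c‖ ≤ k ^ 2 * D := (hAA c).trans (by gcongr)
    have b3 : ‖lc b c‖ ≤ k * D + η * D := (norm_le_of_mem_ladder (m1 c)).trans (by gcongr)
    have b4 : ‖lc ba c‖ ≤ k ^ 2 * D + η * (k * D) :=
      (norm_le_of_mem_ladder (m2 c)).trans (by gcongr)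
    have b5 : ‖lc ab c‖ ≤ η ^ 2 * D + (k ^ 2 * D + η * (k * D)) := by
      rw [hab]
      refine (norm_add_le _ _).trans (add_le_add ?_ b4)
      rw [norm_smul, Complex.norm_real, Real.norm_of_nonneg (by positivity)]
      gcongr
    have b6 : ‖lc bb c‖ ≤ (η ^ 2 * D + (k ^ 2 * D + η * (k * D))) + η * (k * D + η * D) :=
      (norm_le_of_mem_ladder (m3 c)).trans (by gcongr)
    have n1 : 0 ≤ k ^ 2 * D := by positivity
    have n2 : 0 ≤ η * (k * D) := by positivity
    have n3 : 0 ≤ η ^ 2 * D := by positivity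
    have n4 : 0 ≤ k * D := by positivity
    have n5 : 0 ≤ η * D := by positivity
    constructor
    · rw [hadd]
      refine (norm_add_le _ _).trans ?_
      nlinarith
    · rw [hadd, hadd, hadd]
      refine (norm_add_le _ _).trans ?_
      have t1 := norm_add_le (lc ba c) (lc aa c)
      have t2 := norm_add_le (lc bb c) (lc ab c)
      nlinarith
  · refine IsClosed.inter ?_ (IsClosed.inter ?_ ?_)
    · exact hcl.preimage (f := fun t : (Fock H × Fock H) × (Fock H × Fock H) => (t.1.1, t.2.1))
        (by fun_prop)
    · exact hcl.preimage (f := fun t : (Fock H × Fock H) × (Fock H × Fock H) => (t.2.1, t.2.2))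
        (by fun_prop)
    · change IsClosed {t : (Fock H × Fock H) × (Fock H × Fock H) |
        ‖t.2.1‖ ^ 2 ≤ 4 * k ^ 2 * (⟪t.1.1, t.1.2⟫_ℂ).re + 2 * η ^ 2 * ‖t.1.1‖ ^ 2}
      exact isClosed_le (by fun_prop) (by fun_prop)
  · change (lc e c, lc (fun f => b f + a f) c) ∈ (field h).graph ∧
      (lc (fun f => b f + a f) c, lc (fun f => (ba f + aa f) + (bb f + ab f)) c) ∈
        (field h).graph ∧
      ‖lc (fun f => b f + a f) c‖ ^ 2 ≤ 4 * k ^ 2 * (⟪lc e c, lc y c⟫_ℂ).re +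
        2 * η ^ 2 * ‖lc e c‖ ^ 2
    rw [hadd, hadd, hadd, hadd]
    refine ⟨mem_graph_field (m1 c), ?_, ?_⟩
    · have h1 := (field h).graph.add_mem (mem_graph_field (m3 c)) (mem_graph_field (m2 c))
      have h2 : lc ba c + lc aa c + (lc bb c + lc ab c) =
        lc bb c + lc ab c + (lc ba c + lc aa c) := add_comm _ _
      rw [h2]
      exact h1
    · have h1 := norm_sq_of_mem_ladder (m1 c)
      simp only at h1
      have h2 := norm_add_le (lc b c) (lc a c)
      have h3 := hA c
      have h4 : ‖lc b c + lc a c‖ ^ 2 ≤ (‖lc b c‖ + ‖lc a c‖) ^ 2 := by gcongr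
      nlinarith [sq_nonneg (‖lc b c‖ - ‖lc a c‖)]

theorem isPositiveOp_dGamma (hM : IsSelfAdjoint M) (hMpos : IsPositiveOp M) :
    IsPositiveOp (dGamma M) := by
  intro x
  have hx := (dGamma M).mem_graph x
  rw [graph_dGamma hM] at hx
  have hcl : IsClosed {p : Fock H × Fock H | 0 ≤ (⟪p.1, p.2⟫_ℂ).re} :=
    isClosed_le (by fun_prop) (by fun_prop)
  have h1 := closure_minimal (inner_dGammaCore_nonneg hM hMpos) hcl hx
  exact h1

/-- The only property of `M ^ (-1/2)` that is used: `|(h | f)|² ≤ ‖M ^ (-1/2) h‖² (f | M f)`. -/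
theorem norm_inner_sq_le_of_mem_invSqrt (hMpos : IsPositiveOp M) (hMinj : M.toFun.ker = ⊥) {h : H}
    (hh : h ∈ (invSqrt M).domain) (f : M.domain) :
    ‖⟪h, (f : H)⟫_ℂ‖ ^ 2 ≤ ‖invSqrt M ⟨h, hh⟩‖ ^ 2 * (⟪(f : H), M f⟫_ℂ).re := by
  by_cases hS : ∃ S : H →ₗ.[ℂ] H, IsPosSqrt S M
  · set S := posSqrt M with hSdef
    have hSsqrt : IsPosSqrt S M := by
      rw [hSdef, posSqrt, dif_pos hS]
      exact hS.choose_spec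
    obtain ⟨hSsa, -, hSS⟩ := hSsqrt
    have hsym := inner_graph_of_isSelfAdjoint hSsa
    have hker : S.toFun.ker = ⊥ := by
      rw [LinearMap.ker_eq_bot']
      intro x hx
      have h1 : ((x : H), (0 : H)) ∈ S.graph := by
        have := S.mem_graph x
        rwa [show S x = 0 from hx] at this
      have h2 := mem_graph_opComp h1 S.graph.zero_mem
      rw [hSS] at h2
      obtain ⟨w, hw, hw'⟩ := M.mem_graph_iff.1 h2
      have h3 := LinearMap.ker_eq_bot'.1 hMinj w hw'
      rw [h3] at hw
      exact Subtype.ext hw.symm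
    have hv : (invSqrt M ⟨h, hh⟩, h) ∈ S.graph := by
      have h1 := (invSqrt M).mem_graph ⟨h, hh⟩
      change _ ∈ S.inverse.graph at h1
      rw [LinearPMap.inverse_graph hker] at h1
      obtain ⟨⟨v, w⟩, hvw, heq⟩ := h1
      obtain ⟨e1, e2⟩ := Prod.mk.inj heq
      rwa [← e2, ← show w = h from e1]
    have hf : ((f : H), M f) ∈ (opComp S S).graph := by
      rw [hSS]
      exact M.mem_graph f
    obtain ⟨g, hfg, hg⟩ := mem_graph_opComp_iff.1 hf
    have h1 : ⟪h, (f : H)⟫_ℂ = ⟪invSqrt M ⟨h, hh⟩, g⟫_ℂ := hsym _ hv _ hfg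
    have h2 : ‖g‖ ^ 2 = (⟪(f : H), M f⟫_ℂ).re := by
      have := hsym _ hfg _ hg
      simp only at this
      rw [← this]
      exact (inner_self_eq_norm_sq (𝕜 := ℂ) g).symm
    rw [h1, ← h2, ← mul_pow]
    gcongr
    exact norm_inner_le_norm _ _
  -- Every positive self-adjoint operator has a square root, but this is not needed: otherwise
  -- `invSqrt M` is the inverse of an operator with zero range, so that `h = 0`.
  · have h0 : h = 0 := by
      have h1 := hh
      rw [invSqrt, LinearPMap.inverse_domain, posSqrt, dif_neg hS] at h1
      obtain ⟨x, rfl⟩ := h1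
      rfl
    have h1 : ‖⟪h, (f : H)⟫_ℂ‖ ^ 2 = 0 := by simp [h0]
    rw [h1]
    exact mul_nonneg (sq_nonneg _) (hMpos f)

end FieldBounds

end BosonFock

end

open BosonFock in
theorem lemma1 {H : Type*} [NormedAddCommGroup H] [InnerProductSpace ℂ H] [CompleteSpace H]
    (M : H →ₗ.[ℂ] H) (hM : IsSelfAdjoint M) (hMpos : BosonFock.IsPositiveOp M)
    (hMinj : M.toFun.ker = ⊥) (h : H) (hh : h ∈ (BosonFock.invSqrt M).domain) :
    (∀ t : ℝ,
      (BosonFock.dGamma M + (t : ℂ) • BosonFock.field h).domain = (BosonFock.dGamma M).domain ∧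
      IsSelfAdjoint (BosonFock.dGamma M + (t : ℂ) • BosonFock.field h)) ∧
    (‖BosonFock.invSqrt M ⟨h, hh⟩‖ ≤ 1 / 2 →
      (BosonFock.dGamma M -
          (1 / 2 : ℂ) • BosonFock.opComp (BosonFock.field h) (BosonFock.field h)).domain =
        (BosonFock.dGamma M).domain ∧
      BosonFock.HasLowerBound
        (BosonFock.dGamma M -
          (1 / 2 : ℂ) • BosonFock.opComp (BosonFock.field h) (BosonFock.field h))
        (-‖h‖ ^ 2)) := by
  have hform := norm_inner_sq_le_of_mem_invSqrt hMpos hMinj hh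
  have key := fun z hz => exists_field_field hM hMpos (norm_nonneg _) hform (z := z) hz
  have hsymH := isFormalAdjoint_dGamma hM
  have hposH := isPositiveOp_dGamma hM hMpos
  refine ⟨fun t => isSelfAdjoint_add_smul hsymH hposH (fun μ hμ => ?_) (inner_graph_field h)
      (a := 4 * ‖invSqrt M ⟨h, hh⟩‖ ^ 2) (b := 2 * ‖h‖ ^ 2) (by positivity) (by positivity)
      (fun z hz => ?_) t,
    fun hk => hasLowerBound_sub_half_opComp hsymH hposH (inner_graph_field h) fun z hz => ?_⟩
  · rw [graph_dGamma hM]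
    exact exists_resolvent (dGammaCore M) (inner_dGammaCore_nonneg hM hMpos) hμ
      fun ψ hψ => eq_zero_of_inner_dGammaCore_add hM hMpos hμ hψ
  · obtain ⟨p, q, hp, -, hbd⟩ := key z hz
    exact ⟨p, hp, hbd⟩
  · obtain ⟨p, q, hp, hq, hbd⟩ := key z hz
    refine ⟨p, q, hp, hq, hbd.trans ?_⟩
    have h1 := inner_graph_nonneg hposH z hz
    have h2 : 4 * ‖invSqrt M ⟨h, hh⟩‖ ^ 2 ≤ 1 := by nlinarith [norm_nonneg (invSqrt M ⟨h, hh⟩)]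
    have h3 := mul_le_mul_of_nonneg_right h2 h1
    linarith
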